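/- Let $n\ge 1$, $k\ge 2$ be integers and $\varepsilon\in(0,1]$, and write $d_{TV}(P,Q)=\frac12\sum_{i=1}^n|P(i)-Q(i)|$ for probability distributions $P,Q$ on $[n]=\{1,\dots,n\}$. For every constant $c>0$ there is a constant $C>0$, depending only on $c$, such that for all such $n,k,\varepsilon$ the following holds. There exists a (possibly randomised) procedure, which may depend on $n,k,\varepsilon$ and $c$ but not on $P,Q,D_1,\dots,D_k$, that draws $s_1$ independent samples from each of $P$ and $Q$ and $s_2$ independent samples from each of $D_1,\dots,D_k$, and then labels each index $i\in[k]$ by "$P$" or "$Q$", with the following two properties. (1) For all distributions $P,Q$ on $[n]$ with $c\,d_{TV}(P,Q)\ge\varepsilon$ and all $D_1,\dots,D_k$ with $D_i\in\{P,Q\}$ for every $i$, with probability at least $\frac89$ all $k$ labels are simultaneously correct. (2) The total number of samples $T=2s_1+ks_2$ satisfies (with $\log$ the natural logarithm) - $T\le C\left(\frac{n^2k\log k}{\varepsilon^4}\right)^{1/3}$ if $c\,n\ge\frac{k\log k}{\varepsilon^4}$; - $T\le C\,\frac{\sqrt{nk\log k}}{\varepsilon^2}$ if $c\,n\ge k\log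 k$ and $n\le c\,\frac{k\log k}{\varepsilon^4}$; - $T\le C\,\frac{k\log k}{\varepsilon^2}$ if $n\le c\,k\log k$. -/

import Mathlib

open MeasureTheory

/-- Total variation distance of two distributions on `[n]`: half the `ℓ¹` distance. -/
noncomputable def tvDist {n : ℕ} (P Q : PMF (Fin n)) : ℝ :=
  (1 / 2) * ∑ i, |(P i).toReal - (Q i).toReal|

/-- A (possibly randomised) procedure with sample access to `P`, `Q` and `D₁, …, Dₖ`, all on `[n]`.
It draws `s₁` samples from `P`, `s₁` samples from `Q` and `s₂` samples from each `Dᵢ`, and outputs a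
random labelling of `[k]`, whose law is a function of the samples seen and nothing else.
The label `true` means `P`, the label `false` means `Q`. -/
structure ClassificationProcedure (n k : ℕ) where
  /-- number of samples drawn from each of `P` and `Q` -/
  s₁ : ℕ
  /-- number of samples drawn from each `Dᵢ` -/
  s₂ : ℕ
  /-- law of the output, given the samples from `P`, from `Q` and from the `Dᵢ` -/
  rule : (Fin s₁ → Fin n) → (Fin s₁ → Fin n) → (Fin k → Fin s₂ → Fin n) → PMF (Fin k → Bool)

namespace ClassificationProcedure

variable {n k : ℕ}

/-- The total number of samples drawn, from all `k + 2` distributions together. -/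
def sampleCount (A : ClassificationProcedure n k) : ℕ :=
  2 * A.s₁ + k * A.s₂

/-- The joint law `P^{⊗ s₁} ⊗ Q^{⊗ s₁} ⊗ ⨂ᵢ Dᵢ^{⊗ s₂}` of all samples (all independent). -/
noncomputable def sampleLaw (A : ClassificationProcedure n k) (P Q : PMF (Fin n))
    (D : Fin k → PMF (Fin n)) :
    Measure ((Fin A.s₁ → Fin n) × (Fin A.s₁ → Fin n) × (Fin k → Fin A.s₂ → Fin n)) :=
  (Measure.pi fun _ : Fin A.s₁ => P.toMeasure).prod
    ((Measure.pi fun _ : Fin A.s₁ => Q.toMeasure).prod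
      (Measure.pi fun i : Fin k => Measure.pi fun _ : Fin A.s₂ => (D i).toMeasure))

/-- The probability, over the samples and the internal randomness, that all `k` labels are right. -/
noncomputable def successProb (A : ClassificationProcedure n k) (P Q : PMF (Fin n))
    (D : Fin k → PMF (Fin n)) : ENNReal :=
  ∫⁻ ω, (A.rule ω.1 ω.2.1 ω.2.2).toMeasure {σ | ∀ i, D i = if σ i = true then P else Q}
    ∂(A.sampleLaw P Q D)

end ClassificationProcedure

/-! Write `K = k log k`, `d i = P i - Q i` and `s i = P i + Q i`. Each `D i` is classified by a
linear statistic: the empirical mean of a score `f` learned from reference samples, compared with a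
learned threshold. Three independent pairs of reference samples of size `N` are used. The first
gives weights `w i = 1 / (1 + r * count i)`, which damp the heavy elements; the second gives the
score `w i * freqDiff i`, an estimate of `w i * d i`; the third gives the threshold, midway between
the empirical means of the score.

With `M = r * N` the weights behave like `1 / (1 + M * s i)`. The gap between the two means of the
score is then of order at least `S = meanDistSq`, and its second moments are of order at most `S / M
+ 1 / (M * N)`: a signal and a noise term (`measureReal_not_goodWeights_le`,
`measureReal_not_good_score_le`). By Chebyshev, blocks of `m` samples can be told apart with
constant error as soon as `m * M * S` and `m * N * M * S ^ 2` exceed a constant. A majority vote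
over order `log k` blocks lowers the error enough for a union bound over the `k` labels.

Choosing `r = min 1 (n / N)` gives `M = min N n`, and Cauchy-Schwarz gives `S ≥ ε ^ 2 / (c ^ 2 *
n)`. With `m` about `N / K` both sides of the sample budget are of order `N`, and the two conditions
become three lower bounds on `N`. Their maximum is `sampleScale`, and in each regime of the theorem
one of its three terms dominates. -/

/-! ### Moments of empirical means. -/

section EmpiricalMeans

variable {α β : Type*} [MeasurableSpace α] [MeasurableSpace β]

theorem integral_prod_comp_fst (μ : Measure α) (ν : Measure β) [IsProbabilityMeasure μ]
    [IsProbabilityMeasure ν] (f : α → ℝ) : ∫ z, f z.1 ∂μ.prod ν = ∫ a, f a ∂μ := by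
  simpa using integral_prod_mul (μ := μ) (ν := ν) f fun _ => (1 : ℝ)

theorem integral_prod_comp_snd (μ : Measure α) (ν : Measure β) [IsProbabilityMeasure μ]
    [IsProbabilityMeasure ν] (f : β → ℝ) : ∫ z, f z.2 ∂μ.prod ν = ∫ b, f b ∂ν := by
  simpa using integral_prod_mul (μ := μ) (ν := ν) (fun _ => (1 : ℝ)) f

/-- The empirical mean of `g` over the sample `x`. -/
noncomputable def empMean {N : ℕ} (g : α → ℝ) (x : Fin N → α) : ℝ :=
  (∑ j, g (x j)) / N

variable [Finite α] [MeasurableSingletonClass α] [Finite β] [MeasurableSingletonClass β]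

theorem integral_empMean (μ : Measure α) [IsProbabilityMeasure μ] {N : ℕ} (hN : N ≠ 0)
    (g : α → ℝ) :
    ∫ x, empMean g x ∂(Measure.pi fun _ : Fin N => μ) = ∫ a, g a ∂μ := by
  have hN' : (N : ℝ) ≠ 0 := by exact_mod_cast hN
  simp only [empMean]
  rw [integral_div, integral_finsetSum _ fun _ _ => Integrable.of_finite]
  have h : ∀ j : Fin N, ∫ x, g (x j) ∂(Measure.pi fun _ : Fin N => μ) = ∫ a, g a ∂μ := fun j =>
    integral_comp_eval (μ := fun _ : Fin N => μ) (i := j) (f := g)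
      (Integrable.of_finite (μ := μ) (f := g)).aestronglyMeasurable
  simp only [h, Finset.sum_const, Finset.card_univ, Fintype.card_fin, nsmul_eq_mul]
  field_simp

theorem integral_sq_empMean_sub_le (μ : Measure α) [IsProbabilityMeasure μ] {N : ℕ} (hN : N ≠ 0)
    (g : α → ℝ) :
    ∫ x, (empMean g x - ∫ a, g a ∂μ) ^ 2 ∂(Measure.pi fun _ : Fin N => μ)
      ≤ (∫ a, g a ^ 2 ∂μ) / N := by
  have hN' : (0 : ℝ) < N := by positivity
  have hm : ∀ f : (Fin N → α) → ℝ, AEMeasurable f (Measure.pi fun _ : Fin N => μ) := fun f =>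
    (Integrable.of_finite (f := f)).aemeasurable
  have hg : MemLp g 2 μ := MemLp.of_discrete
  have h1 : ∫ x, (empMean g x - ∫ a, g a ∂μ) ^ 2 ∂(Measure.pi fun _ : Fin N => μ)
      = ProbabilityTheory.variance (fun x : Fin N → α => empMean g x)
          (Measure.pi fun _ : Fin N => μ) := by
    rw [ProbabilityTheory.variance_eq_integral (hm _), integral_empMean μ hN]
  have h2 : (fun x : Fin N → α => empMean g x)
      = fun x => (N : ℝ)⁻¹ * (∑ j : Fin N, fun ω : Fin N → α => g (ω j)) x := by
    funext x
    simp [empMean, div_eq_inv_mul]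
  rw [h1, h2, ProbabilityTheory.variance_const_mul,
    ProbabilityTheory.variance_sum_pi (X := fun _ : Fin N => g) fun _ => hg]
  have h3 : ProbabilityTheory.variance g μ ≤ ∫ a, g a ^ 2 ∂μ := by
    have := ProbabilityTheory.variance_le_expectation_sq (X := g) (μ := μ)
      (Integrable.of_finite (f := g)).aestronglyMeasurable
    simpa using this
  simp only [Finset.sum_const, Finset.card_univ, Fintype.card_fin, nsmul_eq_mul]
  calc ((N : ℝ)⁻¹) ^ 2 * (N * ProbabilityTheory.variance g μ)
      = ProbabilityTheory.variance g μ / N := by field_simp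
    _ ≤ _ := by gcongr

/-- Mean squared error of a sum of two independent empirical means. -/
theorem integral_sq_empMean_add_sub_le (μ ν : Measure α) [IsProbabilityMeasure μ]
    [IsProbabilityMeasure ν] {N : ℕ} (hN : N ≠ 0) (g g' : α → ℝ) :
    ∫ z, (empMean g z.1 + empMean g' z.2 - (∫ a, g a ∂μ + ∫ a, g' a ∂ν)) ^ 2
        ∂(Measure.pi fun _ : Fin N => μ).prod (Measure.pi fun _ : Fin N => ν)
      ≤ (∫ a, g a ^ 2 ∂μ + ∫ a, g' a ^ 2 ∂ν) / N := by
  set a := ∫ a, g a ∂μ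
  set b := ∫ a, g' a ∂ν
  set π₁ := Measure.pi fun _ : Fin N => μ
  set π₂ := Measure.pi fun _ : Fin N => ν
  have hexp : ∀ z : (Fin N → α) × (Fin N → α),
      (empMean g z.1 + empMean g' z.2 - (a + b)) ^ 2
        = ((empMean g z.1 - a) ^ 2 + (empMean g' z.2 - b) ^ 2)
          + 2 * ((empMean g z.1 - a) * (empMean g' z.2 - b)) := fun z => by ring
  simp only [hexp]
  rw [integral_add Integrable.of_finite Integrable.of_finite,
    integral_add Integrable.of_finite Integrable.of_finite, integral_const_mul,
    integral_prod_mul (fun x => empMean g x - a) (fun x => empMean g' x - b),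
    integral_prod_comp_fst π₁ π₂ fun x => (empMean g x - a) ^ 2,
    integral_prod_comp_snd π₁ π₂ fun x => (empMean g' x - b) ^ 2]
  have h0 : ∫ x, (empMean g x - a) ∂π₁ = 0 := by
    rw [integral_sub Integrable.of_finite Integrable.of_finite, integral_empMean μ hN]
    simp [a]
  rw [h0, add_div]
  have h1 := integral_sq_empMean_sub_le μ hN g
  have h2 := integral_sq_empMean_sub_le ν hN g'
  simp only [zero_mul, mul_zero, add_zero]
  exact add_le_add h1 h2

end EmpiricalMeans

/-! ### Markov's inequality and conditioning on a first coordinate. -/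

section Markov

variable {α β : Type*} [MeasurableSpace α] [MeasurableSpace β]
variable [Finite α] [MeasurableSingletonClass α] [Finite β] [MeasurableSingletonClass β]

theorem measureReal_le_of_integral_le (μ : Measure α) [IsFiniteMeasure μ] {f : α → ℝ}
    (hf : ∀ a, 0 ≤ f a) {t b : ℝ} (ht : 0 < t) (h : ∫ a, f a ∂μ ≤ t * b) :
    μ.real {a | t ≤ f a} ≤ b := by
  have := mul_meas_ge_le_integral_of_nonneg (μ := μ) (ae_of_all _ hf) Integrable.of_finite t
  exact le_of_mul_le_mul_left (this.trans h) ht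

/-- Fubini, bounding the slices by 1 off `G`. It allows the pairs of samples to be treated one at a
time, each conditionally on the earlier ones being good. -/
theorem measureReal_prod_le (μ : Measure α) (ν : Measure β) [IsProbabilityMeasure μ]
    [IsProbabilityMeasure ν] {G : Set α} {B : Set (α × β)} {a b : ℝ} (hb : 0 ≤ b)
    (hG : μ.real Gᶜ ≤ a) (hB : ∀ x ∈ G, ν.real {y | (x, y) ∈ B} ≤ b) :
    (μ.prod ν).real B ≤ a + b := by
  classical
  have hint : (μ.prod ν).real B = ∫ x, ν.real {y | (x, y) ∈ B} ∂μ := by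
    have h1 : (μ.prod ν).real B = ∫ z, B.indicator 1 z ∂μ.prod ν := by
      rw [integral_indicator_one (Set.toFinite B).measurableSet]
    rw [h1, integral_prod _ Integrable.of_finite]
    congr 1
    funext x
    rw [← integral_indicator_one (Set.toFinite _).measurableSet]
    rfl
  rw [hint]
  have hle : ∀ x, ν.real {y | (x, y) ∈ B} ≤ Gᶜ.indicator 1 x + b := by
    intro x
    by_cases hx : x ∈ G
    · simpa [hx] using hB x hx
    · have : ν.real {y | (x, y) ∈ B} ≤ 1 := measureReal_le_one
      simp only [Set.mem_compl_iff, hx, not_false_eq_true, Set.indicator_of_mem, Pi.one_apply]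
      linarith
  calc ∫ x, ν.real {y | (x, y) ∈ B} ∂μ ≤ ∫ x, (Gᶜ.indicator 1 x + b) ∂μ :=
        integral_mono Integrable.of_finite Integrable.of_finite hle
    _ = μ.real Gᶜ + b := by
        rw [integral_add Integrable.of_finite Integrable.of_finite,
          integral_indicator_one (Set.toFinite _).measurableSet]
        simp
    _ ≤ a + b := by linarith

end Markov

/-- The law of a pair of independent samples of size `N`, the first from `μ`, the second
from `ν`. -/
noncomputable abbrev pairLaw {α : Type*} [MeasurableSpace α] (N : ℕ) (μ ν : Measure α) :
    Measure ((Fin N → α) × (Fin N → α)) :=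
  (Measure.pi fun _ => μ).prod (Measure.pi fun _ => ν)

/-! ### Flattening weights and their second moments. -/

section Flattening

variable {α : Type*} [DecidableEq α]

/-- Number of occurrences of `i` in a pair of samples. -/
def pairCount {N : ℕ} (z : (Fin N → α) × (Fin N → α)) (i : α) : ℕ :=
  (Finset.univ.filter fun j => z.1 j = i).card + (Finset.univ.filter fun j => z.2 j = i).card

/-- The flattening weight of `i`: the inverse of one plus `r` times its number of occurrences. -/
noncomputable def flatWeight {N : ℕ} (r : ℝ) (z : (Fin N → α) × (Fin N → α)) (i : α) : ℝ :=
  1 / (1 + r * pairCount z i)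

theorem flatWeight_pos {N : ℕ} {r : ℝ} (hr : 0 ≤ r) (z : (Fin N → α) × (Fin N → α)) (i : α) :
    0 < flatWeight r z i := by
  unfold flatWeight; positivity

theorem flatWeight_le_one {N : ℕ} {r : ℝ} (hr : 0 ≤ r) (z : (Fin N → α) × (Fin N → α)) (i : α) :
    flatWeight r z i ≤ 1 := by
  unfold flatWeight
  rw [div_le_one (by positivity)]
  have : 0 ≤ r * pairCount z i := by positivity
  linarith

theorem pairCount_eq_empMean {N : ℕ} (hN : N ≠ 0) (z : (Fin N → α) × (Fin N → α)) (i : α) :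
    (pairCount z i : ℝ) = N * (empMean (fun a => if a = i then 1 else 0) z.1
      + empMean (fun a => if a = i then 1 else 0) z.2) := by
  have hN' : (N : ℝ) ≠ 0 := by exact_mod_cast hN
  simp only [pairCount, empMean, Finset.sum_boole, Nat.cast_add]
  field_simp

variable [MeasurableSpace α] [MeasurableSingletonClass α]

theorem integral_ite_eq (μ : Measure α) (i : α) :
    ∫ a, (if a = i then (1 : ℝ) else 0) ∂μ = μ.real {i} := by
  have : (fun a => if a = i then (1 : ℝ) else 0) = ({i} : Set α).indicator 1 := by
    funext a; simp [Set.indicator_apply]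
  rw [this, integral_indicator_one (measurableSet_singleton i)]

variable [Finite α] (μ ν : Measure α) [IsProbabilityMeasure μ] [IsProbabilityMeasure ν]

theorem integral_pairCount {N : ℕ} (hN : N ≠ 0) (i : α) :
    ∫ z, (pairCount z i : ℝ) ∂pairLaw N μ ν = N * (μ.real {i} + ν.real {i}) := by
  simp only [pairCount_eq_empMean hN]
  rw [integral_const_mul, integral_add Integrable.of_finite Integrable.of_finite,
    integral_prod_comp_fst _ _ fun x => empMean _ x,
    integral_prod_comp_snd _ _ fun x => empMean _ x, integral_empMean μ hN,
    integral_empMean ν hN, integral_ite_eq, integral_ite_eq]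

/-- By independence the integral is the power `(1 - p / 2) ^ N`, where `p` is the mass of `i`. This
controls the lower tail of the count. -/
theorem integral_half_pow_card_le (N : ℕ) (i : α) :
    ∫ x, (1 / 2 : ℝ) ^ (Finset.univ.filter fun j => x j = i).card
        ∂(Measure.pi fun _ : Fin N => μ) ≤ Real.exp (-(N * μ.real {i} / 2)) := by
  have h1 : ∀ x : Fin N → α, (1 / 2 : ℝ) ^ (Finset.univ.filter fun j => x j = i).card
      = ∏ j, if x j = i then (1 / 2 : ℝ) else 1 := by
    intro x
    rw [Finset.prod_ite]; simp
  simp only [h1]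
  rw [integral_fintype_prod_eq_pow (ι := Fin N) (μ := μ)
    (fun a => if a = i then (1 / 2 : ℝ) else 1), Fintype.card_fin]
  have h2 : ∀ a, (if a = i then (1 / 2 : ℝ) else 1) = 1 - (1 / 2) * (if a = i then 1 else 0) := by
    intro a; split_ifs <;> norm_num
  simp only [h2]
  rw [integral_sub Integrable.of_finite Integrable.of_finite, integral_const_mul, integral_ite_eq]
  simp only [integral_const, probReal_univ, smul_eq_mul, mul_one]
  have h3 : μ.real {i} ≤ 1 := measureReal_le_one
  calc (1 - 1 / 2 * μ.real {i}) ^ N ≤ (Real.exp (-(1 / 2 * μ.real {i}))) ^ N :=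
        pow_le_pow_left₀ (by linarith) (Real.one_sub_le_exp_neg _) N
    _ = _ := by rw [← Real.exp_nat_mul]; ring_nf

theorem integral_half_pow_pairCount_le (N : ℕ) (i : α) :
    ∫ z, (1 / 2 : ℝ) ^ pairCount z i ∂pairLaw N μ ν
      ≤ Real.exp (-(N * (μ.real {i} + ν.real {i}) / 2)) := by
  simp only [pairCount, pow_add]
  rw [integral_prod_mul
    (fun x : Fin N → α => (1 / 2 : ℝ) ^ (Finset.univ.filter fun j => x j = i).card)
    (fun x : Fin N → α => (1 / 2 : ℝ) ^ (Finset.univ.filter fun j => x j = i).card)]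
  calc _ ≤ Real.exp (-(N * μ.real {i} / 2)) * Real.exp (-(N * ν.real {i} / 2)) :=
        mul_le_mul (integral_half_pow_card_le μ N i) (integral_half_pow_card_le ν N i)
          (integral_nonneg fun x => by positivity) (Real.exp_pos _).le
    _ = _ := by rw [← Real.exp_add]; ring_nf

/-- A count `x` of at least `m / 4` is paid for by the first term. For a smaller one the second term
exceeds 1, because `exp (-x) ≤ (1 / 2) ^ x`. -/
theorem sq_inv_one_add_le {r m : ℝ} (hr : 0 < r) (hm : 0 < m) (x : ℕ) :
    (1 / (1 + r * x)) ^ 2 ≤ 16 / (r * m) ^ 2 + Real.exp (m / 4) * (1 / 2) ^ x := by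
  have hrx : 0 ≤ r * x := by positivity
  rcases le_or_gt (m / 4) x with h | h
  · have h1 : (1 / (1 + r * x)) ^ 2 ≤ 16 / (r * m) ^ 2 := by
      rw [div_pow, one_pow, div_le_div_iff₀ (by positivity) (by positivity), one_mul]
      have h2 : r * m ≤ 4 * (1 + r * x) := by nlinarith
      calc (r * m) ^ 2 ≤ (4 * (1 + r * x)) ^ 2 := pow_le_pow_left₀ (by positivity) h2 2
        _ = _ := by ring
    have : 0 ≤ Real.exp (m / 4) * (1 / 2) ^ x := by positivity
    linarith
  · have h1 : (1 / (1 + r * x)) ^ 2 ≤ 1 :=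
      pow_le_one₀ (by positivity) ((div_le_one (by positivity)).2 (by linarith))
    have h2 : Real.exp (-(x : ℝ)) ≤ (1 / 2) ^ x := by
      have h3 : Real.exp (-1) ≤ 1 / 2 := by
        rw [Real.exp_neg, one_div]
        apply inv_anti₀ (by norm_num)
        have := Real.add_one_le_exp (1 : ℝ)
        linarith
      calc Real.exp (-(x : ℝ)) = Real.exp (-1) ^ x := by rw [← Real.exp_nat_mul]; ring_nf
        _ ≤ _ := pow_le_pow_left₀ (Real.exp_pos _).le h3 x
    have h4 : 1 ≤ Real.exp (m / 4) * (1 / 2) ^ x :=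
      calc 1 ≤ Real.exp (m / 4 + -(x : ℝ)) := Real.one_le_exp (by linarith)
        _ = Real.exp (m / 4) * Real.exp (-(x : ℝ)) := Real.exp_add _ _
        _ ≤ _ := by gcongr
    have : 0 ≤ 16 / (r * m) ^ 2 := by positivity
    linarith

/-- In mean square, and up to a constant, the random weight is no larger than if the count were
replaced by its mean `m`. For `r * m ≤ 1` the bound is trivial; otherwise the lower tail costs `exp
(-m / 4)`, which is at most `32 / m ^ 2`. The constant is `192 = 4 * (16 + 32)`, since `1 + r * m ≤
2 * (r * m)`. -/
theorem integral_flatWeight_sq_le (N : ℕ) {r : ℝ} (hr : 0 < r) (hr1 : r ≤ 1) (i : α) :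
    ∫ z, flatWeight r z i ^ 2 ∂pairLaw N μ ν
      ≤ 192 / (1 + r * N * (μ.real {i} + ν.real {i})) ^ 2 := by
  set m : ℝ := N * (μ.real {i} + ν.real {i}) with hm
  have hm0 : 0 ≤ m := by positivity
  rw [mul_assoc, ← hm]
  rcases le_or_gt (r * m) 1 with h | h
  · have h1 : ∫ z, flatWeight r z i ^ 2 ∂pairLaw N μ ν ≤ 1 := by
      calc ∫ z, flatWeight r z i ^ 2 ∂pairLaw N μ ν ≤ ∫ _, (1 : ℝ) ∂pairLaw N μ ν :=
            integral_mono Integrable.of_finite Integrable.of_finite fun z =>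
              pow_le_one₀ (flatWeight_pos hr.le z i).le (flatWeight_le_one hr.le z i)
        _ = 1 := by simp
    refine h1.trans ?_
    rw [le_div_iff₀ (by positivity)]
    have : 0 ≤ r * m := by positivity
    nlinarith
  · have hmpos : 0 < m := by
      by_contra hcon
      have : m = 0 := le_antisymm (not_lt.1 hcon) hm0
      rw [this] at h; norm_num at h
    have h1 : ∫ z, flatWeight r z i ^ 2 ∂pairLaw N μ ν
        ≤ 16 / (r * m) ^ 2 + Real.exp (m / 4) * Real.exp (-(m / 2)) := by
      calc ∫ z, flatWeight r z i ^ 2 ∂pairLaw N μ ν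
          ≤ ∫ z, (16 / (r * m) ^ 2 + Real.exp (m / 4) * (1 / 2) ^ pairCount z i)
              ∂pairLaw N μ ν :=
            integral_mono Integrable.of_finite Integrable.of_finite fun z =>
              sq_inv_one_add_le hr hmpos _
        _ = 16 / (r * m) ^ 2
            + Real.exp (m / 4) * ∫ z, (1 / 2 : ℝ) ^ pairCount z i ∂pairLaw N μ ν := by
            rw [integral_add Integrable.of_finite Integrable.of_finite, integral_const_mul]
            simp
        _ ≤ _ := by
            have := integral_half_pow_pairCount_le μ ν N i
            gcongr
    have h2 : Real.exp (m / 4) * Real.exp (-(m / 2)) ≤ 32 / (r * m) ^ 2 := by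
      have h3 : (m / 4) ^ 2 / 2 ≤ Real.exp (m / 4) := by
        have := Real.quadratic_le_exp_of_nonneg (x := m / 4) (by positivity)
        linarith
      have h4 : Real.exp (m / 4) * Real.exp (-(m / 2)) = (Real.exp (m / 4))⁻¹ := by
        rw [← Real.exp_add, ← Real.exp_neg]; ring_nf
      rw [h4]
      calc (Real.exp (m / 4))⁻¹ ≤ ((m / 4) ^ 2 / 2)⁻¹ := inv_anti₀ (by positivity) h3
        _ = 32 / m ^ 2 := by field_simp; norm_num
        _ ≤ 32 / (r * m) ^ 2 := by
            have : r * m ≤ m := by nlinarith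
            gcongr
    have h5 : 16 / (r * m) ^ 2 + 32 / (r * m) ^ 2 ≤ 192 / (1 + r * m) ^ 2 := by
      rw [← add_div, div_le_div_iff₀ (by positivity) (by positivity)]
      nlinarith
    linarith

end Flattening

/-! ### Random flattening weights are good with high probability. -/

section GoodWeights

variable {α : Type*} [Fintype α] [MeasurableSpace α] (μ ν : Measure α)

/-- Squared weighted `ℓ²` distance of two measures. -/
noncomputable def wDistSq (w : α → ℝ) : ℝ :=
  ∑ i, w i * (μ.real {i} - ν.real {i}) ^ 2

/-- `wDistSq` for the deterministic weights that the flattening weights fluctuate around. -/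
noncomputable def meanDistSq (M : ℝ) : ℝ :=
  wDistSq μ ν fun i => 1 / (1 + M * (μ.real {i} + ν.real {i}))

/-- The contribution of `μ - ν` to the variance of the weighted statistic. -/
noncomputable def signalVar (w : α → ℝ) : ℝ :=
  ∑ i, (μ.real {i} + ν.real {i}) * w i ^ 2 * (μ.real {i} - ν.real {i}) ^ 2

/-- The contribution of sampling noise to the variance of the weighted statistic. -/
noncomputable def noiseVar (w : α → ℝ) : ℝ :=
  ∑ i, (μ.real {i} + ν.real {i}) ^ 2 * w i ^ 2

/-- Weights for which the weighted statistic has a large mean and a small variance. -/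
structure GoodWeights (M : ℝ) (w : α → ℝ) : Prop where
  meanDistSq_le : meanDistSq μ ν M ≤ 180 * wDistSq μ ν w
  signalVar_le : M * signalVar μ ν w ≤ 34560 * meanDistSq μ ν M
  noiseVar_le : M * noiseVar μ ν w ≤ 69120

theorem meanDistSq_nonneg {M : ℝ} (hM : 0 ≤ M) : 0 ≤ meanDistSq μ ν M :=
  Finset.sum_nonneg fun i _ => mul_nonneg (by positivity) (sq_nonneg _)

variable [MeasurableSingletonClass α] [IsProbabilityMeasure μ] [IsProbabilityMeasure ν]

theorem sum_measureReal_singleton_eq_one : ∑ i, μ.real {i} = 1 := by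
  simp

/-- Cauchy-Schwarz against the denominators `1 + M * (μ.real {i} + ν.real {i})`, whose sum is the
second factor. -/
theorem sq_sum_le_meanDistSq {M : ℝ} (hM : 0 ≤ M) :
    (∑ i, |μ.real {i} - ν.real {i}|) ^ 2
      ≤ meanDistSq μ ν M * (Fintype.card α + 2 * M) := by
  have h1 : ∑ i, (1 + M * (μ.real {i} + ν.real {i})) = Fintype.card α + 2 * M := by
    rw [Finset.sum_add_distrib, ← Finset.mul_sum, Finset.sum_add_distrib,
      sum_measureReal_singleton_eq_one μ, sum_measureReal_singleton_eq_one ν]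
    simp; ring
  rw [← h1]
  apply Finset.sum_sq_le_sum_mul_sum_of_sq_le_mul
  · intro i _; positivity
  · intro i _; positivity
  · intro i _
    have : 0 < 1 + M * (μ.real {i} + ν.real {i}) := by positivity
    rw [sq_abs]
    refine le_of_eq ?_
    field_simp

/-- Flattening weights computed from samples are good with probability at least `59 / 60`. -/
theorem measureReal_not_goodWeights_le [DecidableEq α] {N : ℕ} (hN : N ≠ 0) {r : ℝ}
    (hr : 0 < r) (hr1 : r ≤ 1)
    (hS : 0 < meanDistSq μ ν (r * N)) :
    (pairLaw N μ ν).real {z | ¬ GoodWeights μ ν (r * N) (flatWeight r z)} ≤ 1 / 60 := by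
  set M : ℝ := r * N with hMdef
  have hM : 0 < M := by positivity
  set s : α → ℝ := fun i => μ.real {i} + ν.real {i} with hs
  set d : α → ℝ := fun i => μ.real {i} - ν.real {i} with hd
  have hs0 : ∀ i, 0 ≤ s i := fun i => by positivity
  set v : α → ℝ := fun i => 1 / (1 + M * s i) with hv
  have hb : ∀ i, 0 < 1 + M * s i := fun i => by have := hs0 i; positivity
  have hv0 : ∀ i, 0 < v i := fun i => by have := hb i; positivity
  have hMsv : ∀ i, M * s i * v i ≤ 1 := fun i => by
    simp only [hv, mul_one_div]
    rw [div_le_one (hb i)]; linarith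
  have hSdef : meanDistSq μ ν M = ∑ i, v i * d i ^ 2 := rfl
  set Sb := meanDistSq μ ν M with hSb
  -- A lower bound on `wDistSq` is needed. `F₁` is the companion factor `∑ d ^ 2 * v ^ 2 / w` in the
  -- Cauchy-Schwarz inequality `Sb ^ 2 ≤ wDistSq * F₁`; as `1 / w` is affine in the counts, its mean
  -- is exactly `Sb`.
  let F₁ : (Fin N → α) × (Fin N → α) → ℝ := fun z =>
    ∑ i, (d i ^ 2 * v i ^ 2) * (1 + r * pairCount z i)
  have hF₁0 : ∀ z, 0 ≤ F₁ z := fun z => Finset.sum_nonneg fun i _ => by positivity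
  have hF₂0 : ∀ z : (Fin N → α) × (Fin N → α), 0 ≤ signalVar μ ν (flatWeight r z) := fun z =>
    Finset.sum_nonneg fun i _ => by have := hs0 i; positivity
  have hF₃0 : ∀ z : (Fin N → α) × (Fin N → α), 0 ≤ noiseVar μ ν (flatWeight r z) := fun z =>
    Finset.sum_nonneg fun i _ => by positivity
  have hI₁ : ∫ z, F₁ z ∂pairLaw N μ ν = Sb := by
    rw [hSdef, integral_finsetSum _ fun _ _ => Integrable.of_finite]
    refine Finset.sum_congr rfl fun i _ => ?_
    rw [integral_const_mul, integral_add Integrable.of_finite Integrable.of_finite,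
      integral_const_mul, integral_pairCount μ ν hN]
    have h := hb i
    simp only [integral_const, probReal_univ, smul_eq_mul, one_mul, hv]
    rw [← mul_assoc, ← hMdef]
    change d i ^ 2 * (1 / (1 + M * s i)) ^ 2 * (1 + M * s i) = _
    field_simp
  have hI₂ : ∫ z, signalVar μ ν (flatWeight r z) ∂pairLaw N μ ν ≤ 192 * Sb / M := by
    simp only [signalVar]
    rw [integral_finsetSum _ fun _ _ => Integrable.of_finite, hSdef, le_div_iff₀ hM,
      Finset.sum_mul, Finset.mul_sum]
    refine Finset.sum_le_sum fun i _ => ?_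
    rw [integral_mul_const, integral_const_mul]
    have h := integral_flatWeight_sq_le μ ν N hr hr1 i
    have h' : (192 : ℝ) / (1 + M * s i) ^ 2 = 192 * v i ^ 2 := by
      simp only [hv]; rw [div_pow, one_pow, mul_one_div]
    change _ ≤ 192 / (1 + M * s i) ^ 2 at h
    rw [h'] at h
    calc s i * (∫ z, flatWeight r z i ^ 2 ∂pairLaw N μ ν) * d i ^ 2 * M
        ≤ s i * (192 * v i ^ 2) * d i ^ 2 * M := by
          have := hs0 i
          gcongr
      _ = (M * s i * v i) * (192 * (v i * d i ^ 2)) := by ring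
      _ ≤ 1 * (192 * (v i * d i ^ 2)) :=
          mul_le_mul_of_nonneg_right (hMsv i) (by have := hv0 i; positivity)
      _ = _ := one_mul _
  have hI₃ : ∫ z, noiseVar μ ν (flatWeight r z) ∂pairLaw N μ ν ≤ 384 / M := by
    have hsum : ∑ i, s i = 2 := by
      simp only [hs]
      rw [Finset.sum_add_distrib, sum_measureReal_singleton_eq_one μ,
        sum_measureReal_singleton_eq_one ν]
      norm_num
    have h384 : (384 : ℝ) = ∑ i, 192 * s i := by rw [← Finset.mul_sum, hsum]; norm_num
    simp only [noiseVar]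
    rw [integral_finsetSum _ fun _ _ => Integrable.of_finite, le_div_iff₀ hM,
      Finset.sum_mul, h384]
    refine Finset.sum_le_sum fun i _ => ?_
    rw [integral_const_mul]
    have h := integral_flatWeight_sq_le μ ν N hr hr1 i
    have h' : (192 : ℝ) / (1 + M * s i) ^ 2 = 192 * v i ^ 2 := by
      simp only [hv]; rw [div_pow, one_pow, mul_one_div]
    change _ ≤ 192 / (1 + M * s i) ^ 2 at h
    rw [h'] at h
    have hv1 : v i ≤ 1 := by
      simp only [hv]
      rw [div_le_one (hb i)]
      have : 0 ≤ M * s i := mul_nonneg hM.le (hs0 i)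
      linarith
    calc s i ^ 2 * (∫ z, flatWeight r z i ^ 2 ∂pairLaw N μ ν) * M
        ≤ s i ^ 2 * (192 * v i ^ 2) * M := by gcongr
      _ = (M * s i * v i) * (v i * (192 * s i)) := by ring
      _ ≤ 1 * (1 * (192 * s i)) := by
          have h0 := hs0 i
          have h1 := hv0 i
          have h2 := hMsv i
          gcongr
      _ = _ := by ring
  -- Each of the three summands is nonnegative with mean at most 1, so a single Markov bound at
  -- level `180 = 3 * 60` controls them all. The constants in `GoodWeights` are `180`, `180 * 192`
  -- and `180 * 384`.
  let F : (Fin N → α) × (Fin N → α) → ℝ := fun z =>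
    F₁ z / Sb + M / (192 * Sb) * signalVar μ ν (flatWeight r z)
      + M / 384 * noiseVar μ ν (flatWeight r z)
  have hF0 : ∀ z, 0 ≤ F z := fun z => by
    have h1 := hF₁0 z
    have h2 := hF₂0 z
    have h3 := hF₃0 z
    positivity
  have hIF : ∫ z, F z ∂pairLaw N μ ν ≤ 180 * (1 / 60) := by
    simp only [F]
    rw [integral_add Integrable.of_finite Integrable.of_finite,
      integral_add Integrable.of_finite Integrable.of_finite, integral_div,
      integral_const_mul, integral_const_mul, hI₁]
    have h1 : M / (192 * Sb) * ∫ z, signalVar μ ν (flatWeight r z) ∂pairLaw N μ ν ≤ 1 := by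
      calc _ ≤ M / (192 * Sb) * (192 * Sb / M) := by gcongr
        _ = 1 := by field_simp
    have h2 : M / 384 * ∫ z, noiseVar μ ν (flatWeight r z) ∂pairLaw N μ ν ≤ 1 := by
      calc _ ≤ M / 384 * (384 / M) := by gcongr
        _ = 1 := by field_simp
    rw [div_self hS.ne']
    linarith
  refine le_trans (measureReal_mono ?_)
    (measureReal_le_of_integral_le _ hF0 (by norm_num : (0 : ℝ) < 180) hIF)
  intro z hz
  by_contra hlt
  simp only [Set.mem_ofPred_eq, not_le] at hlt
  apply hz
  have h1 : 0 ≤ F₁ z / Sb := div_nonneg (hF₁0 z) hS.le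
  have h2 : 0 ≤ M / (192 * Sb) * signalVar μ ν (flatWeight r z) :=
    mul_nonneg (by positivity) (hF₂0 z)
  have h3 : 0 ≤ M / 384 * noiseVar μ ν (flatWeight r z) :=
    mul_nonneg (by positivity) (hF₃0 z)
  simp only [F] at hlt
  refine ⟨?_, ?_, ?_⟩
  · have h4 : F₁ z ≤ 180 * Sb := by
      have : F₁ z / Sb ≤ 180 := by linarith
      rwa [div_le_iff₀ hS] at this
    have hcs : Sb ^ 2 ≤ wDistSq μ ν (flatWeight r z) * F₁ z := by
      rw [hSdef]
      apply Finset.sum_sq_le_sum_mul_sum_of_sq_le_mul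
      · intro i _
        have := flatWeight_pos hr.le z i
        positivity
      · intro i _; positivity
      · intro i _
        change _ ≤ flatWeight r z i * d i ^ 2 * _
        have : 0 < 1 + r * (pairCount z i : ℝ) := by positivity
        simp only [flatWeight]
        refine le_of_eq ?_
        field_simp
    have hw0 : 0 ≤ wDistSq μ ν (flatWeight r z) := Finset.sum_nonneg fun i _ => by
      have := flatWeight_pos hr.le z i
      positivity
    have : Sb * Sb ≤ (180 * wDistSq μ ν (flatWeight r z)) * Sb := by nlinarith
    exact le_of_mul_le_mul_right this hS
  · have h4 : M / (192 * Sb) * signalVar μ ν (flatWeight r z) ≤ 180 := by linarith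
    rw [div_mul_eq_mul_div, div_le_iff₀ (by positivity)] at h4
    linarith
  · have h4 : M / 384 * noiseVar μ ν (flatWeight r z) ≤ 180 := by linarith
    linarith

end GoodWeights

/-! ### Learning the score and the threshold. -/

section LearnedScore

variable {α : Type*}

/-- Difference of the empirical frequencies of `i` in the two samples of a pair. -/
noncomputable def freqDiff [DecidableEq α] {N : ℕ} (z : (Fin N → α) × (Fin N → α)) (i : α) : ℝ :=
  empMean (fun a => if a = i then 1 else 0) z.1 - empMean (fun a => if a = i then 1 else 0) z.2

/-- Half the sum of the empirical means of `f` over the two samples of a pair. -/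
noncomputable def pairMidpoint {N : ℕ} (f : α → ℝ) (z : (Fin N → α) × (Fin N → α)) :
    ℝ :=
  (empMean f z.1 + empMean f z.2) / 2

/-- Blocks of `m` samples from `μ` or `ν` can be told apart, by comparing the empirical mean
of `f` with `t`, through Chebyshev's inequality with error at most `1 / 16`. -/
def Separates [MeasurableSpace α] (μ ν : Measure α) (m : ℕ) (f : α → ℝ) (t : ℝ) : Prop :=
  ∃ Δ : ℝ, 0 < Δ ∧ t + Δ ≤ ∫ a, f a ∂μ ∧ ∫ a, f a ∂ν ≤ t - Δ ∧
    16 * (∫ a, f a ^ 2 ∂μ + ∫ a, f a ^ 2 ∂ν) ≤ m * Δ ^ 2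

theorem empMean_neg {N : ℕ} (g : α → ℝ) (x : Fin N → α) :
    empMean (fun a => -g a) x = -empMean g x := by
  simp [empMean, neg_div]

theorem empMean_eq_sum [DecidableEq α] [Fintype α] {N : ℕ} (g : α → ℝ) (x : Fin N → α) :
    empMean g x = ∑ i, g i * empMean (fun a => if a = i then 1 else 0) x := by
  simp only [empMean, mul_div_assoc', ← Finset.sum_div, Finset.mul_sum]
  rw [Finset.sum_comm]
  simp

variable [Fintype α] [MeasurableSpace α] [MeasurableSingletonClass α]

theorem integral_eq_sum_measureReal (μ : Measure α) [IsFiniteMeasure μ] (g : α → ℝ) :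
    ∫ a, g a ∂μ = ∑ i, μ.real {i} * g i := by
  rw [integral_fintype Integrable.of_finite]; rfl

variable (μ ν : Measure α) [IsProbabilityMeasure μ] [IsProbabilityMeasure ν]

/-- By Chebyshev the empirical midpoint is within `S / 8` of the true one. The true means lie at
least `S / 4` from the true midpoint, which leaves a margin `Δ = S / 8`; then `1024 = 16 * 8 ^ 2`.
-/
theorem measureReal_not_separates_midpoint_le {N m : ℕ} (hm : m ≠ 0) (hmN : m ≤ N)
    {f : α → ℝ} {S : ℝ} (hS : 0 < S) (hsep : S / 2 ≤ ∫ a, f a ∂μ - ∫ a, f a ∂ν)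
    (hvar : 1024 * (∫ a, f a ^ 2 ∂μ + ∫ a, f a ^ 2 ∂ν) ≤ m * S ^ 2) :
    (pairLaw N μ ν).real {z | ¬ Separates μ ν m f (pairMidpoint f z)} ≤ 1 / 60 := by
  have hN : N ≠ 0 := by omega
  have hN0 : (0 : ℝ) < N := by positivity
  have hmN' : (m : ℝ) ≤ N := by exact_mod_cast hmN
  set W := ∫ a, f a ^ 2 ∂μ + ∫ a, f a ^ 2 ∂ν with hW
  have h := integral_sq_empMean_add_sub_le μ ν hN f f
  rw [← hW] at h
  have hle : W / N ≤ S ^ 2 / 16 * (1 / 60) := by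
    rw [div_le_iff₀ hN0]
    have : (m : ℝ) * S ^ 2 ≤ N * S ^ 2 := by gcongr
    have : 0 ≤ (N : ℝ) * S ^ 2 := by positivity
    linarith
  refine le_trans (measureReal_mono ?_) (measureReal_le_of_integral_le _ (fun z => sq_nonneg _)
    (by positivity : 0 < S ^ 2 / 16) (h.trans hle))
  intro z hz
  by_contra hlt
  simp only [Set.mem_ofPred_eq, not_le] at hlt
  apply hz
  have h4 := abs_lt_of_sq_lt_sq (b := S / 4) (hlt.trans_le (by ring_nf; rfl)) (by positivity)
  rw [abs_lt] at h4
  refine ⟨S / 8, by positivity, ?_, ?_, ?_⟩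
  · simp only [pairMidpoint]; linarith [h4.2]
  · simp only [pairMidpoint]; linarith [h4.1]
  · rw [← hW]; nlinarith

variable [DecidableEq α]

/-- Squared mean plus variance: `freqDiff` is an unbiased estimate of the difference of the masses.
-/
theorem integral_sq_freqDiff_le {N : ℕ} (hN : N ≠ 0) (i : α) :
    ∫ z, freqDiff z i ^ 2 ∂pairLaw N μ ν
      ≤ (μ.real {i} - ν.real {i}) ^ 2 + (μ.real {i} + ν.real {i}) / N := by
  set d := μ.real {i} - ν.real {i} with hd
  have h1 : ∫ z, (freqDiff z i - d) ^ 2 ∂pairLaw N μ ν ≤ (μ.real {i} + ν.real {i}) / N := by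
    have h := integral_sq_empMean_add_sub_le μ ν hN (fun a => if a = i then 1 else 0)
      (fun a => -if a = i then 1 else 0)
    simp only [integral_neg, integral_ite_eq, empMean_neg] at h
    simp only [neg_sq, ite_pow, one_pow, ne_eq, OfNat.ofNat_ne_zero, not_false_eq_true, zero_pow,
      integral_ite_eq] at h
    simpa only [freqDiff, sub_eq_add_neg, hd] using h
  have h2 : ∫ z, freqDiff z i ∂pairLaw N μ ν = d := by
    simp only [freqDiff]
    rw [integral_sub Integrable.of_finite Integrable.of_finite,
      integral_prod_comp_fst _ _ fun x => empMean _ x,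
      integral_prod_comp_snd _ _ fun x => empMean _ x, integral_empMean μ hN,
      integral_empMean ν hN, integral_ite_eq, integral_ite_eq]
  have h3 : ∀ z : (Fin N → α) × (Fin N → α),
      freqDiff z i ^ 2 = (freqDiff z i - d) ^ 2 + (2 * d * freqDiff z i - d ^ 2) := fun z => by
    ring
  simp only [h3]
  rw [integral_add Integrable.of_finite Integrable.of_finite,
    integral_sub Integrable.of_finite Integrable.of_finite, integral_const_mul, h2]
  simp only [integral_const, probReal_univ, smul_eq_mul, one_mul]
  linarith

/-- The score `i ↦ w i * freqDiff z i` has, with probability at least `59 / 60`, a large gap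
between its means under `μ` and `ν`, and a small variance. -/
theorem measureReal_not_good_score_le {N m : ℕ} (hm : m ≠ 0) (hmN : m ≤ N) {M : ℝ} (hM : 0 < M)
    {w : α → ℝ} (hw : GoodWeights μ ν M w) (hS : 0 < meanDistSq μ ν M)
    (h₁ : 10 ^ 15 ≤ m * M * meanDistSq μ ν M)
    (h₂ : 10 ^ 15 ≤ m * N * M * meanDistSq μ ν M ^ 2) :
    (pairLaw N μ ν).real {z | ¬ (wDistSq μ ν w / 2
        ≤ ∫ a, w a * freqDiff z a ∂μ - ∫ a, w a * freqDiff z a ∂ν ∧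
      1024 * (∫ a, (w a * freqDiff z a) ^ 2 ∂μ + ∫ a, (w a * freqDiff z a) ^ 2 ∂ν)
        ≤ m * wDistSq μ ν w ^ 2)} ≤ 1 / 60 := by
  have hN : N ≠ 0 := by omega
  have hm0 : (0 : ℝ) < m := by positivity
  have hN0 : (0 : ℝ) < N := by positivity
  have hmN' : (m : ℝ) ≤ N := by exact_mod_cast hmN
  obtain ⟨hS', hV₁, hV₂⟩ := hw
  set S := wDistSq μ ν w with hSdef
  set Sb := meanDistSq μ ν M
  set V₁ := signalVar μ ν w with hV₁def
  set V₂ := noiseVar μ ν w with hV₂def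
  have hSpos : 0 < S := by linarith
  have hSb2 : Sb ^ 2 ≤ 32400 * S ^ 2 := by nlinarith
  have hV₁' : V₁ ≤ 2 / 10 ^ 6 * (m * S ^ 2) := by
    have : M * V₁ * 10 ^ 15 ≤ M * (34560 * m * Sb ^ 2) := by nlinarith
    have h : V₁ * 10 ^ 15 ≤ 34560 * m * Sb ^ 2 := by
      rw [mul_assoc] at this
      exact le_of_mul_le_mul_left this hM
    have : 34560 * (m : ℝ) * Sb ^ 2 ≤ 34560 * m * (32400 * S ^ 2) := by gcongr
    have : 0 ≤ (m : ℝ) * S ^ 2 := by positivity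
    linarith
  have hV₂' : V₂ / N ≤ 3 / 10 ^ 6 * (m * S ^ 2) := by
    rw [div_le_iff₀ hN0]
    have : M * (V₂ * 10 ^ 15) ≤ M * (69120 * (m * N * Sb ^ 2)) := by nlinarith
    have h := le_of_mul_le_mul_left this hM
    have : 69120 * ((m : ℝ) * N * Sb ^ 2) ≤ 69120 * (m * N * (32400 * S ^ 2)) := by gcongr
    have : 0 ≤ (m : ℝ) * N * S ^ 2 := by positivity
    linarith
  let sep : (Fin N → α) × (Fin N → α) → ℝ := fun z =>
    ∫ a, w a * freqDiff z a ∂μ - ∫ a, w a * freqDiff z a ∂ν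
  let W : (Fin N → α) × (Fin N → α) → ℝ := fun z =>
    ∫ a, (w a * freqDiff z a) ^ 2 ∂μ + ∫ a, (w a * freqDiff z a) ^ 2 ∂ν
  -- The gap is bilinear in `d` and `freqDiff`, so the roles can be exchanged: it is also the
  -- difference of the empirical means, over the second pair, of the fixed function `g = w * d`. Its
  -- mean is `S` and the relevant second moment is `V₁`.
  have hsep : ∫ z, (sep z - S) ^ 2 ∂pairLaw N μ ν ≤ V₁ / N := by
    let g : α → ℝ := fun i => w i * (μ.real {i} - ν.real {i})
    have h := integral_sq_empMean_add_sub_le μ ν hN g fun i => -g i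
    simp only [integral_neg, empMean_neg, neg_sq] at h
    have e₁ : ∀ z : (Fin N → α) × (Fin N → α),
        empMean g z.1 + -empMean g z.2 = sep z := fun z => by
      simp only [sep]
      rw [empMean_eq_sum g z.1, empMean_eq_sum g z.2, integral_eq_sum_measureReal,
        integral_eq_sum_measureReal, ← Finset.sum_neg_distrib, ← Finset.sum_add_distrib,
        ← Finset.sum_sub_distrib]
      refine Finset.sum_congr rfl fun i _ => ?_
      simp only [g, freqDiff]; ring
    have e₂ : ∫ a, g a ∂μ + -∫ a, g a ∂ν = S := by
      rw [integral_eq_sum_measureReal, integral_eq_sum_measureReal, ← Finset.sum_neg_distrib,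
        ← Finset.sum_add_distrib, hSdef, wDistSq]
      refine Finset.sum_congr rfl fun i _ => ?_
      simp only [g]; ring
    have e₃ : ∫ a, g a ^ 2 ∂μ + ∫ a, g a ^ 2 ∂ν = V₁ := by
      rw [integral_eq_sum_measureReal, integral_eq_sum_measureReal,
        ← Finset.sum_add_distrib, hV₁def, signalVar]
      refine Finset.sum_congr rfl fun i _ => ?_
      simp only [g]; ring
    simpa only [e₁, e₂, e₃] using h
  have hWeq : ∀ z, W z = ∑ i, ((μ.real {i} + ν.real {i}) * w i ^ 2) * freqDiff z i ^ 2 :=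
    fun z => by
      simp only [W]
      rw [integral_eq_sum_measureReal, integral_eq_sum_measureReal, ← Finset.sum_add_distrib]
      refine Finset.sum_congr rfl fun i _ => ?_
      ring
  have hWint : ∫ z, W z ∂pairLaw N μ ν ≤ V₁ + V₂ / N := by
    simp only [hWeq]
    rw [integral_finsetSum _ fun _ _ => Integrable.of_finite, hV₁def, hV₂def, signalVar,
      noiseVar, Finset.sum_div, ← Finset.sum_add_distrib]
    refine Finset.sum_le_sum fun i _ => ?_
    rw [integral_const_mul]
    calc _ ≤ ((μ.real {i} + ν.real {i}) * w i ^ 2)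
          * ((μ.real {i} - ν.real {i}) ^ 2 + (μ.real {i} + ν.real {i}) / N) := by
          have := integral_sq_freqDiff_le μ ν hN i
          gcongr
      _ = _ := by ring
  have hW0 : ∀ z, 0 ≤ W z := fun z => by
    rw [hWeq]
    exact Finset.sum_nonneg fun i _ => by positivity
  -- Normalised so that `F z < 1` forces both conclusions; its mean is at most `7 / 1000`.
  let F : (Fin N → α) × (Fin N → α) → ℝ := fun z =>
    4 / S ^ 2 * (sep z - S) ^ 2 + 1024 / (m * S ^ 2) * W z
  have hF0 : ∀ z, 0 ≤ F z := fun z => by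
    have := hW0 z
    positivity
  have hFint : ∫ z, F z ∂pairLaw N μ ν ≤ 1 * (1 / 60) := by
    simp only [F]
    rw [integral_add Integrable.of_finite Integrable.of_finite, integral_const_mul,
      integral_const_mul]
    have h1 : 4 / S ^ 2 * ∫ z, (sep z - S) ^ 2 ∂pairLaw N μ ν ≤ 1 / 1000 := by
      rw [div_mul_eq_mul_div, div_le_iff₀ (by positivity)]
      have : V₁ / N ≤ 2 / 10 ^ 6 * S ^ 2 := by
        rw [div_le_iff₀ hN0]
        have : (m : ℝ) * S ^ 2 ≤ N * S ^ 2 := by gcongr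
        linarith
      have : 0 ≤ S ^ 2 := by positivity
      linarith
    have h2 : 1024 / (m * S ^ 2) * ∫ z, W z ∂pairLaw N μ ν ≤ 6 / 1000 := by
      rw [div_mul_eq_mul_div, div_le_iff₀ (by positivity)]
      have : 0 ≤ (m : ℝ) * S ^ 2 := by positivity
      linarith
    linarith
  refine le_trans (measureReal_mono ?_) (measureReal_le_of_integral_le _ hF0 one_pos hFint)
  intro z hz
  by_contra hlt
  simp only [Set.mem_ofPred_eq, not_le, F] at hlt
  apply hz
  have h1 : 0 ≤ 4 / S ^ 2 * (sep z - S) ^ 2 := by positivity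
  have h2 : 0 ≤ 1024 / (m * S ^ 2) * W z := by
    have := hW0 z
    positivity
  constructor
  · have h3 : 4 / S ^ 2 * (sep z - S) ^ 2 < 1 := by linarith
    rw [div_mul_eq_mul_div, div_lt_one (by positivity)] at h3
    have h4 := abs_lt_of_sq_lt_sq (a := 2 * (sep z - S)) (b := S) (by linarith) hSpos.le
    have := (abs_lt.1 h4).1
    change S / 2 ≤ sep z
    linarith
  · have h3 : 1024 / (m * S ^ 2) * W z < 1 := by linarith
    rw [div_mul_eq_mul_div, div_lt_one (by positivity)] at h3
    exact h3.le

/-- A score and a threshold learned from three independent pairs of samples: the first gives the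
weights, the second the score, the third the threshold. -/
theorem measureReal_not_separates_le {N m : ℕ} (hm : m ≠ 0) (hmN : m ≤ N) {r : ℝ} (hr : 0 < r)
    (hr1 : r ≤ 1) (hS : 0 < meanDistSq μ ν (r * N))
    (h₁ : 10 ^ 15 ≤ m * (r * N) * meanDistSq μ ν (r * N))
    (h₂ : 10 ^ 15 ≤ m * N * (r * N) * meanDistSq μ ν (r * N) ^ 2) :
    ((pairLaw N μ ν).prod ((pairLaw N μ ν).prod (pairLaw N μ ν))).real
      {z | ¬ Separates μ ν m (fun i => flatWeight r z.1 i * freqDiff z.2.1 i)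
        (pairMidpoint (fun i => flatWeight r z.1 i * freqDiff z.2.1 i) z.2.2)} ≤ 1 / 20 := by
  have hN : N ≠ 0 := by omega
  have hM : 0 < r * N := by positivity
  have hlast : ∀ x : (Fin N → α) × (Fin N → α), GoodWeights μ ν (r * N) (flatWeight r x) →
      ((pairLaw N μ ν).prod (pairLaw N μ ν)).real
        {z | ¬ Separates μ ν m (fun i => flatWeight r x i * freqDiff z.1 i)
          (pairMidpoint (fun i => flatWeight r x i * freqDiff z.1 i) z.2)} ≤ 1 / 60 + 1 / 60 := by
    intro x hx
    have hpos : 0 < wDistSq μ ν (flatWeight r x) := by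
      have := hx.meanDistSq_le
      linarith
    refine measureReal_prod_le (G := {z | wDistSq μ ν (flatWeight r x) / 2
        ≤ ∫ a, flatWeight r x a * freqDiff z a ∂μ - ∫ a, flatWeight r x a * freqDiff z a ∂ν ∧
      1024 * (∫ a, (flatWeight r x a * freqDiff z a) ^ 2 ∂μ
          + ∫ a, (flatWeight r x a * freqDiff z a) ^ 2 ∂ν)
        ≤ m * wDistSq μ ν (flatWeight r x) ^ 2}) _ _ (by norm_num) ?_ ?_
    · exact measureReal_not_good_score_le μ ν hm hmN hM hx hS h₁ h₂
    · intro y hy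
      rw [Set.mem_ofPred_eq] at hy
      exact measureReal_not_separates_midpoint_le μ ν hm hmN
        (f := fun i => flatWeight r x i * freqDiff y i) hpos hy.1 hy.2
  have hfirst := measureReal_prod_le (pairLaw N μ ν) ((pairLaw N μ ν).prod (pairLaw N μ ν))
    (G := {z | GoodWeights μ ν (r * N) (flatWeight r z)})
    (B := {z | ¬ Separates μ ν m (fun i => flatWeight r z.1 i * freqDiff z.2.1 i)
        (pairMidpoint (fun i => flatWeight r z.1 i * freqDiff z.2.1 i) z.2.2)})
    (a := 1 / 60) (b := 1 / 60 + 1 / 60) (by norm_num)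
    (measureReal_not_goodWeights_le μ ν hN hr hr1 hS) hlast
  exact hfirst.trans (by norm_num)

end LearnedScore

/-! ### Amplification by majority. -/

section Majority

variable {β : Type*} [MeasurableSpace β] [Finite β] [MeasurableSingletonClass β]

/-- At least half of `L` independent trials fail with probability at most `2 ^ (-L)`, if each
fails with probability at most `1 / 16`. -/
theorem measureReal_half_fail_le (π : Measure β) [IsProbabilityMeasure π] (B : β → Prop)
    [DecidablePred B] (hB : π.real {b | B b} ≤ 1 / 16) (L : ℕ) :
    (Measure.pi fun _ : Fin L => π).real
      {z | L ≤ 2 * (Finset.univ.filter fun l => B (z l)).card} ≤ (1 / 2) ^ L := by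
  have h1 : ∀ z : Fin L → β, (16 : ℝ) ^ (Finset.univ.filter fun l => B (z l)).card
      = ∏ l, if B (z l) then (16 : ℝ) else 1 := fun z => by
    rw [Finset.prod_ite]; simp
  have h2 : ∫ b, (if B b then (16 : ℝ) else 1) ∂π = 1 + 15 * π.real {b | B b} := by
    have : ∀ b, (if B b then (16 : ℝ) else 1) = 1 + 15 * {b | B b}.indicator 1 b := fun b => by
      by_cases hb : B b <;> simp [hb]
      norm_num
    simp only [this]
    rw [integral_add Integrable.of_finite Integrable.of_finite, integral_const_mul,
      integral_indicator_one (Set.toFinite _).measurableSet]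
    simp
  -- Exponential moment: each trial contributes a factor at most `1 + 15 / 16 ≤ 2`, while at least
  -- half failing makes the integrand at least `4 ^ L`. The bound `2 ^ L` is written as `4 ^ L * (1
  -- / 2) ^ L` to suit Markov's inequality.
  have h3 : ∫ z, (16 : ℝ) ^ (Finset.univ.filter fun l => B (z l)).card
      ∂(Measure.pi fun _ : Fin L => π) ≤ 4 ^ L * (1 / 2) ^ L := by
    simp only [h1]
    rw [integral_fintype_prod_eq_pow (ι := Fin L) (μ := π) (fun b => if B b then (16 : ℝ) else 1),
      Fintype.card_fin, h2, ← mul_pow]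
    have : 0 ≤ π.real {b | B b} := measureReal_nonneg
    exact pow_le_pow_left₀ (by positivity) (by linarith) L
  refine le_trans (measureReal_mono ?_) (measureReal_le_of_integral_le _
    (fun z => by positivity) (by positivity : (0 : ℝ) < 4 ^ L) h3)
  intro z hz
  rw [Set.mem_ofPred_eq] at hz ⊢
  calc (4 : ℝ) ^ L ≤ 4 ^ (2 * (Finset.univ.filter fun l => B (z l)).card) :=
        pow_le_pow_right₀ (by norm_num) hz
    _ = _ := by rw [pow_mul]; norm_num

end Majority

/-! ### The error of the block test. -/

section BlockTest

variable {α : Type*}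

/-- Majority vote over the blocks on whether the empirical mean of `f` exceeds `t`. -/
noncomputable def blockTest {L m : ℕ} (f : α → ℝ) (t : ℝ) (z : Fin L → Fin m → α) : Bool :=
  decide (L < 2 * (Finset.univ.filter fun l => t < empMean f (z l)).card)

variable [MeasurableSpace α] [Finite α] [MeasurableSingletonClass α]

theorem measureReal_empMean_deviation_le (ρ : Measure α) [IsProbabilityMeasure ρ] {m : ℕ}
    (hm : m ≠ 0) (f : α → ℝ) {Δ : ℝ} (hΔ : 0 < Δ) (hvar : 16 * ∫ a, f a ^ 2 ∂ρ ≤ m * Δ ^ 2) :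
    (Measure.pi fun _ : Fin m => ρ).real {x | Δ ≤ |empMean f x - ∫ a, f a ∂ρ|} ≤ 1 / 16 := by
  have hm0 : (0 : ℝ) < m := by positivity
  have h := integral_sq_empMean_sub_le ρ hm f
  have hle : (∫ a, f a ^ 2 ∂ρ) / m ≤ Δ ^ 2 * (1 / 16) := by
    rw [div_le_iff₀ hm0]; linarith
  refine le_trans (measureReal_mono ?_) (measureReal_le_of_integral_le _ (fun z => sq_nonneg _)
    (by positivity : 0 < Δ ^ 2) (h.trans hle))
  intro x hx
  rw [Set.mem_ofPred_eq] at hx ⊢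
  rw [← sq_abs (empMean f x - _)]
  exact pow_le_pow_left₀ hΔ.le hx 2

variable {μ ν : Measure α} {m : ℕ}
  {f : α → ℝ} {t : ℝ}

theorem Separates.measureReal_blockTest_ne_true_le [IsProbabilityMeasure μ]
    (h : Separates μ ν m f t) (hm : m ≠ 0)
    (L : ℕ) :
    (Measure.pi fun _ : Fin L => Measure.pi fun _ : Fin m => μ).real
      {z | blockTest f t z ≠ true} ≤ (1 / 2) ^ L := by
  classical
  obtain ⟨Δ, hΔ, h1, -, hvar⟩ := h
  have hν : 0 ≤ ∫ a, f a ^ 2 ∂ν := integral_nonneg fun a => sq_nonneg _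
  have hB : (Measure.pi fun _ : Fin m => μ).real {x | ¬ t < empMean f x} ≤ 1 / 16 := by
    refine le_trans (measureReal_mono ?_)
      (measureReal_empMean_deviation_le μ hm f hΔ (by linarith))
    intro x hx
    rw [Set.mem_ofPred_eq] at hx ⊢
    rw [abs_sub_comm]
    exact le_trans (by linarith) (le_abs_self _)
  refine le_trans (measureReal_mono ?_) (measureReal_half_fail_le _ _ hB L)
  intro z hz
  simp only [Set.mem_ofPred_eq, blockTest, ne_eq, decide_eq_true_eq] at hz ⊢
  have := Finset.card_filter_add_card_filter_not (s := (Finset.univ : Finset (Fin L)))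
    (fun l => t < empMean f (z l))
  simp only [Finset.card_univ, Fintype.card_fin] at this
  omega

theorem Separates.measureReal_blockTest_ne_false_le [IsProbabilityMeasure ν]
    (h : Separates μ ν m f t) (hm : m ≠ 0)
    (L : ℕ) :
    (Measure.pi fun _ : Fin L => Measure.pi fun _ : Fin m => ν).real
      {z | blockTest f t z ≠ false} ≤ (1 / 2) ^ L := by
  classical
  obtain ⟨Δ, hΔ, -, h2, hvar⟩ := h
  have hμ : 0 ≤ ∫ a, f a ^ 2 ∂μ := integral_nonneg fun a => sq_nonneg _
  have hB : (Measure.pi fun _ : Fin m => ν).real {x | t < empMean f x} ≤ 1 / 16 := by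
    refine le_trans (measureReal_mono ?_)
      (measureReal_empMean_deviation_le ν hm f hΔ (by linarith))
    intro x hx
    rw [Set.mem_ofPred_eq] at hx ⊢
    exact le_trans (by linarith) (le_abs_self _)
  refine le_trans (measureReal_mono ?_) (measureReal_half_fail_le _ _ hB L)
  intro z hz
  simp only [Set.mem_ofPred_eq, blockTest, ne_eq, decide_eq_false_iff_not, not_not] at hz ⊢
  exact hz.le

end BlockTest

/-! ### Cutting the samples into independent blocks. -/

section Relabelling

theorem measureReal_preimage_equiv {A B : Type*} [MeasurableSpace A] [MeasurableSpace B]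
    [Finite A] [Finite B] [MeasurableSingletonClass A] [MeasurableSingletonClass B]
    {μ : Measure A} {ν : Measure B} (e : A ≃ B) (h : ∀ a, μ {a} = ν {e a}) (S : Set B) :
    μ.real (e ⁻¹' S) = ν.real S := by
  have hmap : μ.map e = ν := by
    refine Measure.ext_of_singleton fun b => ?_
    rw [Measure.map_apply (measurable_of_finite _) (measurableSet_singleton b)]
    have : e ⁻¹' {b} = {e.symm b} := by
      ext a; simp [Equiv.eq_symm_apply]
    rw [this, h, Equiv.apply_symm_apply]
  rw [← hmap, map_measureReal_apply (measurable_of_finite _) (Set.toFinite S).measurableSet]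

/-- Cutting a sample of size `a * b` into `a` blocks of size `b`. -/
def blockEquiv (α : Type*) (a b : ℕ) : (Fin (a * b) → α) ≃ (Fin a → Fin b → α) :=
  (Equiv.arrowCongr finProdFinEquiv.symm (Equiv.refl α)).trans (Equiv.curry _ _ _)

/-- Pairing up the entries of two triples. -/
def triplePairEquiv (X : Type*) : (Fin 3 → X) × (Fin 3 → X) ≃ (X × X) × (X × X) × (X × X) where
  toFun z := ((z.1 0, z.2 0), (z.1 1, z.2 1), (z.1 2, z.2 2))
  invFun u := (![u.1.1, u.2.1.1, u.2.2.1], ![u.1.2, u.2.1.2, u.2.2.2])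
  left_inv z := by
    ext i <;> fin_cases i <;> rfl
  right_inv u := rfl

/-- All samples, rearranged into three pairs of samples from the two reference distributions and
blocks of samples from each of the distributions to be labelled. -/
def sampleEquiv (α : Type*) (k N L m : ℕ) :
    (Fin (3 * N) → α) × (Fin (3 * N) → α) × (Fin k → Fin (L * m) → α) ≃
      (((Fin N → α) × (Fin N → α)) × ((Fin N → α) × (Fin N → α)) × ((Fin N → α) × (Fin N → α)))
        × (Fin k → Fin L → Fin m → α) :=
  (Equiv.prodAssoc _ _ _).symm.trans (Equiv.prodCongr
    ((Equiv.prodCongr (blockEquiv α 3 N) (blockEquiv α 3 N)).trans (triplePairEquiv _))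
    (Equiv.piCongrRight fun _ => blockEquiv α L m))

theorem measure_prod_singleton {A B : Type*} [MeasurableSpace A] [MeasurableSpace B]
    (μ : Measure A) (ν : Measure B) [SFinite ν] (z : A × B) :
    μ.prod ν {z} = μ {z.1} * ν {z.2} := by
  rw [← Measure.prod_prod, Set.singleton_prod_singleton]

theorem pi_singleton_eq_prod_blocks {α : Type*} [MeasurableSpace α] (ρ : Measure α)
    [IsProbabilityMeasure ρ] {a b : ℕ} (x : Fin (a * b) → α) :
    (Measure.pi fun _ => ρ) {x} = ∏ i, ∏ j, ρ {blockEquiv α a b x i j} := by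
  rw [Measure.pi_singleton, ← Fintype.prod_prod_type', ← finProdFinEquiv.prod_comp]
  rfl

/-- Both sides are the same product of point masses in a different order. On finite spaces this
suffices for the rearrangement to preserve measure, by `measureReal_preimage_equiv`. -/
theorem sampleEquiv_singleton {α : Type*} [MeasurableSpace α] {k N L m : ℕ} (μ ν : Measure α)
    (ρ : Fin k → Measure α) [IsProbabilityMeasure μ] [IsProbabilityMeasure ν]
    [∀ i, IsProbabilityMeasure (ρ i)]
    (ω : (Fin (3 * N) → α) × (Fin (3 * N) → α) × (Fin k → Fin (L * m) → α)) :
    ((Measure.pi fun _ => μ).prod ((Measure.pi fun _ => ν).prod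
        (Measure.pi fun i => Measure.pi fun _ => ρ i))) {ω}
      = (((pairLaw N μ ν).prod ((pairLaw N μ ν).prod (pairLaw N μ ν))).prod
        (Measure.pi fun i => Measure.pi fun _ => Measure.pi fun _ => ρ i))
          {sampleEquiv α k N L m ω} := by
  obtain ⟨x, y, z⟩ := ω
  have hΨ : sampleEquiv α k N L m (x, y, z)
      = (((blockEquiv α 3 N x 0, blockEquiv α 3 N y 0), (blockEquiv α 3 N x 1, blockEquiv α 3 N y 1),
        (blockEquiv α 3 N x 2, blockEquiv α 3 N y 2)), fun i => blockEquiv α L m (z i)) := rfl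
  have hz : (Measure.pi fun i => Measure.pi fun _ => ρ i) {z}
      = ∏ i, ∏ l, ∏ j, ρ i {blockEquiv α L m (z i) l j} := by
    rw [Measure.pi_singleton]
    exact Finset.prod_congr rfl fun i _ => pi_singleton_eq_prod_blocks (ρ i) (z i)
  rw [hΨ]
  simp only [measure_prod_singleton]
  rw [hz, pi_singleton_eq_prod_blocks μ x, pi_singleton_eq_prod_blocks ν y]
  simp only [Measure.pi_singleton, Fin.prod_univ_three]
  ring

end Relabelling

/-! ### The procedure and its success probability. -/

section Procedure

/-- Label each distribution by a majority vote over `L` blocks of size `m`, using a score and a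
threshold learned from three pairs of reference samples of size `N`. -/
noncomputable def flattenedProcedure (n k N L m : ℕ) (r : ℝ) : ClassificationProcedure n k where
  s₁ := 3 * N
  s₂ := L * m
  rule x y z :=
    let u := sampleEquiv (Fin n) k N L m (x, y, z)
    let f : Fin n → ℝ := fun i => flatWeight r u.1.1 i * freqDiff u.1.2.1 i
    PMF.pure fun i => blockTest f (pairMidpoint f u.1.2.2) (u.2 i)

theorem toReal_eq_measureReal {n : ℕ} (P : PMF (Fin n)) (i : Fin n) :
    (P i).toReal = P.toMeasure.real {i} := by
  rw [measureReal_def, P.toMeasure_apply_singleton i (measurableSet_singleton i)]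

theorem ClassificationProcedure.le_successProb_of_pure {n k : ℕ} (A : ClassificationProcedure n k)
    (label : (Fin A.s₁ → Fin n) × (Fin A.s₁ → Fin n) × (Fin k → Fin A.s₂ → Fin n) →
      Fin k → Bool)
    (hA : ∀ ω, A.rule ω.1 ω.2.1 ω.2.2 = PMF.pure (label ω)) (P Q : PMF (Fin n))
    (D : Fin k → PMF (Fin n))
    (h : (A.sampleLaw P Q D).real {ω | ∃ i, D i ≠ if label ω i = true then P else Q} ≤ 1 / 9) :
    8 / 9 ≤ A.successProb P Q D := by
  classical
  have : IsProbabilityMeasure (A.sampleLaw P Q D) := by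
    unfold ClassificationProcedure.sampleLaw; infer_instance
  set G : Set ((Fin A.s₁ → Fin n) × (Fin A.s₁ → Fin n) × (Fin k → Fin A.s₂ → Fin n)) :=
    {ω | ∀ i, D i = if label ω i = true then P else Q} with hG
  have h1 : A.successProb P Q D = A.sampleLaw P Q D G := by
    unfold ClassificationProcedure.successProb
    rw [← lintegral_indicator_one (Set.toFinite G).measurableSet]
    refine lintegral_congr fun ω => ?_
    rw [hA, PMF.toMeasure_pure, Measure.dirac_apply' _ (Set.toFinite _).measurableSet]
    rfl
  have h2 : {ω | ∃ i, D i ≠ if label ω i = true then P else Q} = Gᶜ := by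
    ext ω; simp [hG]
  rw [h2, probReal_compl_eq_one_sub (Set.toFinite G).measurableSet] at h
  have h3 : (8 / 9 : ENNReal) = ENNReal.ofReal (8 / 9) := by
    rw [ENNReal.ofReal_div_of_pos (by norm_num)]; norm_num
  rw [h1, h3, ← ofReal_measureReal]
  exact ENNReal.ofReal_le_ofReal (by linarith)

/-- The failure budget `1 / 9` covers `1 / 20` for a bad score or threshold and `1 / 18` for the
union bound over the `k` votes, each wrong with probability at most `(1 / 2) ^ L`. -/
theorem flattenedProcedure_successProb {n k N L m : ℕ} {r : ℝ} (hm : m ≠ 0) (hmN : m ≤ N)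
    (hr : 0 < r) (hr1 : r ≤ 1) (hL : 18 * (k : ℝ) ≤ 2 ^ L) {P Q : PMF (Fin n)}
    (hS : 0 < meanDistSq P.toMeasure Q.toMeasure (r * N))
    (h₁ : 10 ^ 15 ≤ m * (r * N) * meanDistSq P.toMeasure Q.toMeasure (r * N))
    (h₂ : 10 ^ 15 ≤ m * N * (r * N) * meanDistSq P.toMeasure Q.toMeasure (r * N) ^ 2)
    {D : Fin k → PMF (Fin n)} (hD : ∀ i, D i = P ∨ D i = Q) :
    8 / 9 ≤ (flattenedProcedure n k N L m r).successProb P Q D := by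
  classical
  let lab : (((Fin N → Fin n) × (Fin N → Fin n)) × ((Fin N → Fin n) × (Fin N → Fin n)) ×
      ((Fin N → Fin n) × (Fin N → Fin n))) → (Fin L → Fin m → Fin n) → Bool := fun u v =>
    blockTest (fun i => flatWeight r u.1 i * freqDiff u.2.1 i)
      (pairMidpoint (fun i => flatWeight r u.1 i * freqDiff u.2.1 i) u.2.2) v
  refine ClassificationProcedure.le_successProb_of_pure _
    (fun ω i => lab (sampleEquiv (Fin n) k N L m ω).1 ((sampleEquiv (Fin n) k N L m ω).2 i))
    (fun ω => rfl) P Q D ?_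
  set T := (pairLaw N P.toMeasure Q.toMeasure).prod
    ((pairLaw N P.toMeasure Q.toMeasure).prod (pairLaw N P.toMeasure Q.toMeasure)) with hT
  set R : Measure (Fin k → Fin L → Fin m → Fin n) :=
    Measure.pi fun i => Measure.pi fun _ => Measure.pi fun _ => (D i).toMeasure with hR
  have htrans := measureReal_preimage_equiv (sampleEquiv (Fin n) k N L m)
    (sampleEquiv_singleton P.toMeasure Q.toMeasure fun i => (D i).toMeasure)
    {w | ∃ i, D i ≠ if lab w.1 (w.2 i) = true then P else Q}
  refine le_trans (le_of_eq htrans) ?_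
  have hb : (k : ℝ) * (1 / 2) ^ L ≤ 1 / 18 := by
    rw [one_div_pow, mul_one_div, div_le_iff₀ (by positivity)]
    linarith
  have hbad : ∀ u, Separates P.toMeasure Q.toMeasure m
      (fun i => flatWeight r u.1 i * freqDiff u.2.1 i)
      (pairMidpoint (fun i => flatWeight r u.1 i * freqDiff u.2.1 i) u.2.2) →
      R.real {v | ∃ i, D i ≠ if lab u (v i) = true then P else Q} ≤ 1 / 18 := by
    intro u hu
    refine le_trans ?_ hb
    have hset : {v : Fin k → Fin L → Fin m → Fin n |
        ∃ i, D i ≠ if lab u (v i) = true then P else Q}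
        = ⋃ i, {v | D i ≠ if lab u (v i) = true then P else Q} := by
      ext v; simp
    rw [hset]
    refine (measureReal_iUnion_fintype_le _).trans ?_
    have hone : ∀ i ∈ Finset.univ,
        R.real {v | D i ≠ if lab u (v i) = true then P else Q} ≤ (1 / 2) ^ L := by
      intro i _
      have hev : R.real {v | D i ≠ if lab u (v i) = true then P else Q}
          = (Measure.pi fun _ : Fin L => Measure.pi fun _ : Fin m => (D i).toMeasure).real
            {b | D i ≠ if lab u b = true then P else Q} := by
        have := (measurePreserving_eval (fun i => Measure.pi fun _ : Fin L =>
          Measure.pi fun _ : Fin m => (D i).toMeasure) i).measureReal_preimage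
          (Set.toFinite {b | D i ≠ if lab u b = true then P else Q}).measurableSet.nullMeasurableSet
        exact this
      rw [hev]
      rcases hD i with h | h
      · rw [h]
        refine (measureReal_mono ?_).trans (hu.measureReal_blockTest_ne_true_le hm L)
        intro b hb' hcon
        apply hb'
        change lab u b = true at hcon
        simp [hcon]
      · rw [h]
        refine (measureReal_mono ?_).trans (hu.measureReal_blockTest_ne_false_le hm L)
        intro b hb' hcon
        apply hb'
        change lab u b = false at hcon
        simp [hcon]
    refine (Finset.sum_le_sum hone).trans ?_
    simp
  have := measureReal_prod_le T R
    (G := {u | Separates P.toMeasure Q.toMeasure m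
      (fun i => flatWeight r u.1 i * freqDiff u.2.1 i)
      (pairMidpoint (fun i => flatWeight r u.1 i * freqDiff u.2.1 i) u.2.2)})
    (B := {w | ∃ i, D i ≠ if lab w.1 (w.2 i) = true then P else Q})
    (a := 1 / 20) (b := 1 / 18) (by norm_num)
    (measureReal_not_separates_le P.toMeasure Q.toMeasure hm hmN hr hr1 hS h₁ h₂) hbad
  exact this.trans (by norm_num)

end Procedure

/-! ### Choice of parameters and the three regimes. -/

section Parameters

theorem le_const_mul_of_pow_le {a b c : ℝ} {j : ℕ} (hj : j ≠ 0) (hb : 0 ≤ b) (hc : 1 ≤ c)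
    (h : a ^ j ≤ c * b ^ j) : a ≤ c * b := by
  refine le_of_pow_le_pow_left₀ hj (by positivity) (h.trans ?_)
  rw [mul_pow]
  exact mul_le_mul_of_nonneg_right (le_self_pow₀ hc hj) (by positivity)

/-- Here `r * N = min N n`; the cap at `n` keeps the Cauchy-Schwarz factor `n + 2 * (r * N)` below
`3 * n`, so that `meanDistSq` is at least `σ`. If the minimum is `N`, the two Chebyshev conditions
follow from `h₂` and `h₃`; if it is `n`, from `h₁` and `h₂`. -/
theorem flattenedProcedure_successProb_of_tvDist {n k N L m : ℕ} {c ε K B : ℝ} (hn : 0 < n)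
    (hc : 1 ≤ c) (hε : 0 < ε) (hε1 : ε ≤ 1) (hK : 0 < K) (hB : B = 10 ^ 15 * c ^ 4)
    (hm : m ≠ 0) (hmN : m ≤ N) (hmK : N / K ≤ m) (hL : 18 * (k : ℝ) ≤ 2 ^ L)
    (h₁ : B * K ≤ N * ε ^ 2) (h₂ : B ^ 2 * (n * K) ≤ N ^ 2 * ε ^ 4)
    (h₃ : B ^ 3 * (n ^ 2 * K) ≤ N ^ 3 * ε ^ 4) {P Q : PMF (Fin n)} (hPQ : ε ≤ c * tvDist P Q)
    {D : Fin k → PMF (Fin n)} (hD : ∀ i, D i = P ∨ D i = Q) :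
    8 / 9 ≤ (flattenedProcedure n k N L m (min 1 (n / N))).successProb P Q D := by
  have hN0 : 0 < N := by omega
  have hNr : (0 : ℝ) < N := by exact_mod_cast hN0
  have hnr : (0 : ℝ) < n := by exact_mod_cast hn
  have hc0 : 0 < c := by linarith
  have hc4 : 1 ≤ c ^ 4 := one_le_pow₀ hc
  have hc24 : c ^ 2 ≤ c ^ 4 := pow_le_pow_right₀ hc (by norm_num)
  have hB15 : 10 ^ 15 ≤ B := by rw [hB]; linarith
  have hB1 : 1 ≤ B := by linarith
  set r : ℝ := min 1 (n / N) with hr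
  have hr0 : 0 < r := lt_min one_pos (by positivity)
  have hrN : r * N = min (N : ℝ) n := by
    rw [hr, min_mul_of_nonneg _ _ hNr.le, one_mul, div_mul_cancel₀ _ hNr.ne']
  have hM0 : 0 < r * N := by positivity
  have hMn : r * N ≤ n := hrN ▸ min_le_right _ _
  set Sb := meanDistSq P.toMeasure Q.toMeasure (r * N) with hSb
  set σ : ℝ := ε ^ 2 / (c ^ 2 * n) with hσ
  have hσ0 : 0 < σ := by positivity
  have hσS : σ ≤ Sb := by
    have h := sq_sum_le_meanDistSq P.toMeasure Q.toMeasure hM0.le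
    simp only [← toReal_eq_measureReal, Fintype.card_fin, ← hSb] at h
    have htv : ∑ i, |(P i).toReal - (Q i).toReal| = 2 * tvDist P Q := by
      unfold tvDist; ring
    rw [htv] at h
    have hSb0 : 0 ≤ Sb := meanDistSq_nonneg _ _ hM0.le
    have h5 : Sb * (n + 2 * (r * N)) ≤ Sb * (3 * n) := by gcongr; linarith
    have h6 : ε ^ 2 ≤ c ^ 2 * tvDist P Q ^ 2 := by
      rw [← mul_pow]; exact pow_le_pow_left₀ hε.le hPQ 2
    rw [hσ, div_le_iff₀ (by positivity)]
    have h7 : 4 * (c ^ 2 * tvDist P Q ^ 2) ≤ c ^ 2 * (Sb * (3 * n)) := by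
      have : c ^ 2 * (2 * tvDist P Q) ^ 2 ≤ c ^ 2 * (Sb * (3 * n)) := by
        gcongr; exact h.trans h5
      linarith
    nlinarith [sq_nonneg ε]
  have hε42 : ε ^ 4 ≤ ε ^ 2 := pow_le_pow_of_le_one hε.le hε1 (by norm_num)
  have hm1 : N ≤ m * K := by rwa [div_le_iff₀ hK] at hmK
  have e₁ : 10 ^ 15 ≤ m * (r * N) * σ := by
    rw [hσ, mul_div_assoc', le_div_iff₀ (by positivity)]
    have key : 10 ^ 15 * (c ^ 2 * n) * K ≤ N * (r * N) * ε ^ 2 := by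
      rw [hrN]
      rcases min_choice (N : ℝ) n with h | h
      · rw [h]
        calc 10 ^ 15 * (c ^ 2 * n) * K ≤ 10 ^ 15 * (c ^ 4 * n) * K := by gcongr
          _ = B * (n * K) := by rw [hB]; ring
          _ ≤ B ^ 2 * (n * K) := by
            gcongr
            nlinarith
          _ ≤ N ^ 2 * ε ^ 4 := h₂
          _ ≤ N ^ 2 * ε ^ 2 := by gcongr
          _ = _ := by ring
      · rw [h]
        calc 10 ^ 15 * (c ^ 2 * n) * K ≤ 10 ^ 15 * (c ^ 4 * n) * K := by gcongr
          _ = (B * K) * n := by rw [hB]; ring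
          _ ≤ (N * ε ^ 2) * n := by gcongr
          _ = _ := by ring
    refine le_of_mul_le_mul_right (key.trans ?_) hK
    calc N * (r * N) * ε ^ 2 ≤ (m * K) * (r * N) * ε ^ 2 := by gcongr
      _ = _ := by ring
  have e₂ : 10 ^ 15 ≤ m * N * (r * N) * σ ^ 2 := by
    rw [hσ, div_pow, mul_div_assoc', le_div_iff₀ (by positivity)]
    have key : 10 ^ 15 * (c ^ 2 * n) ^ 2 * K ≤ N * N * (r * N) * (ε ^ 2) ^ 2 := by
      rw [hrN]
      have hB2 : B ≤ B ^ 2 := le_self_pow₀ hB1 (by norm_num)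
      have hB3 : B ≤ B ^ 3 := le_self_pow₀ hB1 (by norm_num)
      rcases min_choice (N : ℝ) n with h | h
      · rw [h]
        calc 10 ^ 15 * (c ^ 2 * n) ^ 2 * K = B * (n ^ 2 * K) := by rw [hB]; ring
          _ ≤ B ^ 3 * (n ^ 2 * K) := by gcongr
          _ ≤ N ^ 3 * ε ^ 4 := h₃
          _ = _ := by ring
      · rw [h]
        calc 10 ^ 15 * (c ^ 2 * n) ^ 2 * K = B * (n * K) * n := by rw [hB]; ring
          _ ≤ B ^ 2 * (n * K) * n := by gcongr
          _ ≤ (N ^ 2 * ε ^ 4) * n := by gcongr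
          _ = _ := by ring
    refine le_of_mul_le_mul_right (key.trans ?_) hK
    calc N * N * (r * N) * (ε ^ 2) ^ 2 ≤ (m * K) * N * (r * N) * (ε ^ 2) ^ 2 := by gcongr
      _ = _ := by ring
  refine flattenedProcedure_successProb hm hmN hr0 (min_le_left _ _) hL (hσ0.trans_le hσS)
    (e₁.trans ?_) (e₂.trans ?_) hD
  · gcongr
  · gcongr

theorem eighteen_mul_le_two_pow {k : ℕ} (hk : 2 ≤ k) :
    18 * (k : ℝ) ≤ 2 ^ ⌈10 * Real.log k⌉₊ := by
  have hk2 : (2 : ℝ) ≤ k := by exact_mod_cast hk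
  have hk0 : (0 : ℝ) < k := by linarith
  have hlog : 0 < Real.log k := Real.log_pos (by linarith)
  have h2 := Real.log_two_gt_d9
  -- The constant 10 is large enough because `18 * k ≤ k ^ 6` and `6 < 10 * log 2`.
  calc 18 * (k : ℝ) ≤ 2 ^ 5 * k := by linarith
    _ ≤ k ^ 5 * k := by gcongr
    _ = Real.exp (Real.log k * 6) := by
        rw [Real.exp_mul, Real.exp_log hk0, ← Nat.cast_ofNat (n := 6), Real.rpow_natCast]
        ring
    _ ≤ Real.exp (Real.log 2 * (10 * Real.log k)) := Real.exp_le_exp.2 (by nlinarith)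
    _ ≤ Real.exp (Real.log 2 * ⌈10 * Real.log k⌉₊) := by
        have := Nat.le_ceil (10 * Real.log k)
        gcongr
    _ = _ := by rw [Real.exp_mul, Real.exp_log (by norm_num), Real.rpow_natCast]

/-- The sample size for the reference distributions, up to a constant factor. -/
noncomputable def sampleScale (n : ℕ) (K ε : ℝ) : ℝ :=
  max ((n ^ 2 * K / ε ^ 4) ^ (1 / 3 : ℝ)) (max (√(n * K) / ε ^ 2) (K / ε ^ 2))

theorem exists_procedure {n k : ℕ} {c ε : ℝ} (hn : 0 < n) (hk : 2 ≤ k) (hc : 1 ≤ c)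
    (hε : 0 < ε) (hε1 : ε ≤ 1) :
    ∃ A : ClassificationProcedure n k,
      (∀ (P Q : PMF (Fin n)) (D : Fin k → PMF (Fin n)), ε ≤ c * tvDist P Q →
        (∀ i, D i = P ∨ D i = Q) → 8 / 9 ≤ A.successProb P Q D) ∧
      (A.sampleCount : ℝ) ≤ 60 * (10 ^ 15 * c ^ 4) * sampleScale n (k * Real.log k) ε := by
  have hk2 : (2 : ℝ) ≤ k := by exact_mod_cast hk
  have hlog : 0.69 ≤ Real.log k := by
    have := Real.log_two_gt_d9
    have := Real.log_le_log (by norm_num) hk2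
    norm_num at *; linarith
  set K : ℝ := k * Real.log k with hK
  have hK1 : 1 ≤ K := by nlinarith
  have hK0 : 0 < K := by linarith
  set B : ℝ := 10 ^ 15 * c ^ 4 with hB
  have hB1 : 1 ≤ B := by
    have : 1 ≤ c ^ 4 := one_le_pow₀ hc
    linarith
  have hB0 : 0 < B := by linarith
  set M := sampleScale n K ε with hM
  have hMV : K / ε ^ 2 ≤ M := (le_max_right _ _).trans (le_max_right _ _)
  have hMZ : √(n * K) / ε ^ 2 ≤ M := (le_max_left _ _).trans (le_max_right _ _)
  have hMY : (n ^ 2 * K / ε ^ 4) ^ (1 / 3 : ℝ) ≤ M := le_max_left _ _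
  have hMK : K ≤ M := by
    refine le_trans ?_ hMV
    rw [le_div_iff₀ (by positivity)]
    have : ε ^ 2 ≤ 1 := pow_le_one₀ hε.le hε1
    nlinarith
  have hM1 : 1 ≤ M := hK1.trans hMK
  set N := ⌈B * M⌉₊ with hN
  have hBN : B * M ≤ N := Nat.le_ceil _
  have hBM1 : 1 ≤ B * M := by nlinarith
  have hN2 : (N : ℝ) ≤ 2 * (B * M) := by
    have := (Nat.ceil_lt_add_one (by positivity : 0 ≤ B * M)).le
    linarith
  have hKN : K ≤ N := by nlinarith
  have hN0 : (0 : ℝ) < N := by linarith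
  -- This block size balances the budget: `k` distributions with order `log k` blocks each use order
  -- `K * m`, hence order `N`, samples. Rounding up costs at most a factor 2 since `N / K ≥ 1`.
  set m := ⌈N / K⌉₊ with hm
  have hNm : (N : ℝ) / K ≤ m := Nat.le_ceil _
  have hNK1 : 1 ≤ (N : ℝ) / K := by rwa [one_le_div hK0]
  have hm2 : (m : ℝ) ≤ 2 * (N / K) := by
    have := (Nat.ceil_lt_add_one (by positivity : 0 ≤ (N : ℝ) / K)).le
    linarith
  have hm0 : m ≠ 0 := by
    have : (0 : ℝ) < m := by linarith
    exact_mod_cast this.ne'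
  have hmN : m ≤ N := Nat.ceil_le.2 (div_le_self hN0.le hK1)
  have hε2 : 0 < ε ^ 2 := by positivity
  have h₁ : B * K ≤ N * ε ^ 2 := by
    have h : B * (K / ε ^ 2) ≤ N := (mul_le_mul_of_nonneg_left hMV hB0.le).trans hBN
    rwa [mul_div_assoc', div_le_iff₀ hε2] at h
  have h₂ : B ^ 2 * (n * K) ≤ N ^ 2 * ε ^ 4 := by
    have h : B * (√(n * K) / ε ^ 2) ≤ N := (mul_le_mul_of_nonneg_left hMZ hB0.le).trans hBN
    rw [mul_div_assoc', div_le_iff₀ hε2] at h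
    calc B ^ 2 * (n * K) = (B * √(n * K)) ^ 2 := by rw [mul_pow B, Real.sq_sqrt (by positivity)]
      _ ≤ (N * ε ^ 2) ^ 2 := pow_le_pow_left₀ (by positivity) h 2
      _ = _ := by ring
  have h₃ : B ^ 3 * (n ^ 2 * K) ≤ N ^ 3 * ε ^ 4 := by
    have h : B * (n ^ 2 * K / ε ^ 4) ^ (1 / 3 : ℝ) ≤ N :=
      (mul_le_mul_of_nonneg_left hMY hB0.le).trans hBN
    have h' := pow_le_pow_left₀ (by positivity) h 3
    rw [mul_pow, ← Real.rpow_mul_natCast (by positivity)] at h'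
    norm_num at h'
    rwa [mul_div_assoc', div_le_iff₀ (by positivity)] at h'
  refine ⟨flattenedProcedure n k N ⌈10 * Real.log k⌉₊ m (min 1 (n / N)), ?_, ?_⟩
  · intro P Q D hPQ hD
    exact flattenedProcedure_successProb_of_tvDist hn hc hε hε1 hK0 hB hm0 hmN hNm
      (eighteen_mul_le_two_pow hk) h₁ h₂ h₃ hPQ hD
  · have hL : (⌈10 * Real.log k⌉₊ : ℝ) ≤ 12 * Real.log k := by
      have := (Nat.ceil_lt_add_one (by positivity : 0 ≤ 10 * Real.log k)).le
      linarith
    simp only [ClassificationProcedure.sampleCount, flattenedProcedure]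
    push_cast
    calc 2 * (3 * (N : ℝ)) + k * (⌈10 * Real.log k⌉₊ * m)
        ≤ 2 * (3 * N) + k * ((12 * Real.log k) * (2 * (N / K))) := by gcongr
      _ = 6 * N + 24 * (K * (N / K)) := by rw [hK]; ring
      _ = 30 * N := by rw [mul_div_cancel₀ _ hK0.ne']; ring
      _ ≤ 60 * B * M := by linarith

variable {n : ℕ} {c K ε : ℝ}

/-- Comparing integer powers avoids the roots: if `Y`, `Z`, `V` are the three terms of the maximum,
then `Z ^ 6 / Y ^ 6 = K / (ε ^ 4 * n)` and `V ^ 2 / Z ^ 2 = K / n`. These ratios decide which term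
dominates, here and in the other two regimes. -/
theorem sampleScale_le_of_large (hn : 0 < n) (hc : 1 ≤ c) (hK : 0 < K) (hε : 0 < ε)
    (hε1 : ε ≤ 1) (h : K / ε ^ 4 ≤ c * n) :
    sampleScale n K ε ≤ c ^ 2 * (n ^ 2 * K / ε ^ 4) ^ (1 / 3 : ℝ) := by
  have hn0 : (0 : ℝ) < n := by exact_mod_cast hn
  set Y := (n ^ 2 * K / ε ^ 4) ^ (1 / 3 : ℝ) with hY
  have hY0 : 0 < Y := by positivity
  have hY3 : Y ^ 3 = n ^ 2 * K / ε ^ 4 := by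
    rw [hY, ← Real.rpow_mul_natCast (by positivity)]; norm_num
  set Z := √(n * K) / ε ^ 2 with hZ
  have hZ0 : 0 < Z := by positivity
  have hZ2 : Z ^ 2 = n * (K / ε ^ 4) := by
    rw [hZ, div_pow, Real.sq_sqrt (by positivity)]; ring
  have hZY : Z ≤ c * Y := by
    refine le_const_mul_of_pow_le (j := 6) (by norm_num) hY0.le hc ?_
    calc Z ^ 6 = Z ^ 2 * Z ^ 4 := by ring
      _ ≤ (n * (c * n)) * Z ^ 4 := by
          rw [hZ2]; gcongr
      _ = c * (n ^ 2 * (Z ^ 2) ^ 2) := by ring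
      _ = c * (Y ^ 3) ^ 2 := by rw [hZ2, hY3]; ring
      _ = c * Y ^ 6 := by ring
  have hVZ : K / ε ^ 2 ≤ c * Z := by
    refine le_const_mul_of_pow_le (j := 2) (by norm_num) hZ0.le hc ?_
    have hKn : K ≤ c * n := le_trans
      ((le_div_iff₀ (by positivity)).2 (mul_le_of_le_one_right hK.le (pow_le_one₀ hε.le hε1))) h
    rw [hZ2]
    calc (K / ε ^ 2) ^ 2 = K * (K / ε ^ 4) := by ring
      _ ≤ (c * n) * (K / ε ^ 4) := by gcongr
      _ = _ := by ring
  have hcY : c * Y ≤ c ^ 2 * Y := by gcongr; exact le_self_pow₀ hc (by norm_num)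
  refine max_le ?_ (max_le (hZY.trans hcY) ?_)
  · exact le_mul_of_one_le_left hY0.le (one_le_pow₀ hc)
  · calc K / ε ^ 2 ≤ c * Z := hVZ
      _ ≤ c * (c * Y) := by gcongr
      _ = _ := by ring

theorem sampleScale_le_of_medium (hn : 0 < n) (hc : 1 ≤ c) (hK : 0 < K) (hε : 0 < ε)
    (h : K ≤ c * n) (h' : n ≤ c * (K / ε ^ 4)) :
    sampleScale n K ε ≤ c ^ 2 * (√(n * K) / ε ^ 2) := by
  have hn0 : (0 : ℝ) < n := by exact_mod_cast hn
  set Y := (n ^ 2 * K / ε ^ 4) ^ (1 / 3 : ℝ) with hY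
  have hY0 : 0 < Y := by positivity
  have hY3 : Y ^ 3 = n ^ 2 * K / ε ^ 4 := by
    rw [hY, ← Real.rpow_mul_natCast (by positivity)]; norm_num
  set Z := √(n * K) / ε ^ 2 with hZ
  have hZ0 : 0 < Z := by positivity
  have hZ2 : Z ^ 2 = n * (K / ε ^ 4) := by
    rw [hZ, div_pow, Real.sq_sqrt (by positivity)]; ring
  have hYZ : Y ≤ c * Z := by
    refine le_const_mul_of_pow_le (j := 6) (by norm_num) hZ0.le hc ?_
    calc Y ^ 6 = (Y ^ 3) ^ 2 := by ring
      _ = n * n * (n * (K / ε ^ 4)) ^ 2 := by rw [hY3]; ring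
      _ ≤ n * (c * (K / ε ^ 4)) * (n * (K / ε ^ 4)) ^ 2 := by gcongr
      _ = c * (n * (K / ε ^ 4)) ^ 3 := by ring
      _ = c * Z ^ 6 := by rw [← hZ2]; ring
  have hVZ : K / ε ^ 2 ≤ c * Z := by
    refine le_const_mul_of_pow_le (j := 2) (by norm_num) hZ0.le hc ?_
    rw [hZ2]
    calc (K / ε ^ 2) ^ 2 = K * (K / ε ^ 4) := by ring
      _ ≤ (c * n) * (K / ε ^ 4) := by gcongr
      _ = _ := by ring
  have hcZ : c * Z ≤ c ^ 2 * Z := by gcongr; exact le_self_pow₀ hc (by norm_num)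
  exact max_le (hYZ.trans hcZ)
    (max_le (le_mul_of_one_le_left hZ0.le (one_le_pow₀ hc)) (hVZ.trans hcZ))

theorem sampleScale_le_of_small (hc : 1 ≤ c) (hK : 0 < K) (hε : 0 < ε)
    (hε1 : ε ≤ 1) (h : n ≤ c * K) : sampleScale n K ε ≤ c ^ 2 * (K / ε ^ 2) := by
  set V := K / ε ^ 2 with hV
  have hV0 : 0 < V := by positivity
  have hc2 : 1 ≤ c ^ 2 := one_le_pow₀ hc
  have hYV : (n ^ 2 * K / ε ^ 4) ^ (1 / 3 : ℝ) ≤ c ^ 2 * V := by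
    refine le_const_mul_of_pow_le (j := 3) (by norm_num) hV0.le hc2 ?_
    rw [← Real.rpow_mul_natCast (by positivity)]
    norm_num
    calc n ^ 2 * K / ε ^ 4 ≤ (c * K) ^ 2 * K / ε ^ 4 := by gcongr
      _ = c ^ 2 * K ^ 3 / ε ^ 4 := by ring
      _ ≤ c ^ 2 * K ^ 3 / ε ^ 6 :=
          div_le_div_of_nonneg_left (by positivity) (by positivity)
            (pow_le_pow_of_le_one hε.le hε1 (by norm_num))
      _ = c ^ 2 * V ^ 3 := by rw [hV]; ring
  have hZV : √(n * K) / ε ^ 2 ≤ c * V := by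
    refine le_const_mul_of_pow_le (j := 2) (by norm_num) hV0.le hc ?_
    rw [div_pow, Real.sq_sqrt (by positivity)]
    calc n * K / (ε ^ 2) ^ 2 ≤ (c * K) * K / (ε ^ 2) ^ 2 := by gcongr
      _ = c * V ^ 2 := by rw [hV]; ring
  have hcV : c * V ≤ c ^ 2 * V := by gcongr; exact le_self_pow₀ hc (by norm_num)
  exact max_le hYV (max_le (hZV.trans hcV) (le_mul_of_one_le_left hV0.le hc2))

end Parameters

theorem theorem3p1 (c : ℝ) (hc : 0 < c) :
    ∃ C : ℝ, 0 < C ∧ ∀ (n k : ℕ) (ε : ℝ), 2 ≤ k → 0 < ε → ε ≤ 1 →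
      ∃ A : ClassificationProcedure n k,
        (∀ (P Q : PMF (Fin n)) (D : Fin k → PMF (Fin n)),
          ε ≤ c * tvDist P Q → (∀ i, D i = P ∨ D i = Q) →
            8 / 9 ≤ A.successProb P Q D) ∧
        (k * Real.log k / ε ^ 4 ≤ c * n →
          (A.sampleCount : ℝ) ≤ C * (n ^ 2 * k * Real.log k / ε ^ 4) ^ (1 / 3 : ℝ)) ∧
        (k * Real.log k ≤ c * n → n ≤ c * (k * Real.log k / ε ^ 4) →
          (A.sampleCount : ℝ) ≤ C * (Real.sqrt (n * k * Real.log k) / ε ^ 2)) ∧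
        (n ≤ c * (k * Real.log k) →
          (A.sampleCount : ℝ) ≤ C * (k * Real.log k / ε ^ 2)) := by
  -- All hypotheses weaken as `c` grows, so `c` may be replaced by a constant that is at least 1.
  set b := max c 1 with hb
  have hcb : c ≤ b := le_max_left _ _
  have hb1 : 1 ≤ b := le_max_right _ _
  have hb0 : 0 < b := by linarith
  refine ⟨60 * (10 ^ 15 * b ^ 4) * b ^ 2, by positivity, ?_⟩
  intro n k ε hk hε hε1
  have hlog : 0 < Real.log k := Real.log_pos (by exact_mod_cast hk)
  have hk0 : (0 : ℝ) < k := by positivity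
  have hK0 : 0 < k * Real.log k := by positivity
  rcases Nat.eq_zero_or_pos n with rfl | hn
  · refine ⟨⟨0, 0, fun _ _ _ => PMF.pure fun _ => true⟩, fun P => ?_, fun _ => ?_,
      fun _ _ => ?_, fun _ => ?_⟩
    -- For `n = 0` there are no distributions, so the procedure without samples succeeds vacuously.
    · exact P.support_nonempty.some.elim0
    all_goals
      simp only [ClassificationProcedure.sampleCount, mul_zero, add_zero, Nat.cast_zero]
      positivity
  obtain ⟨A, hA, hT⟩ := exists_procedure (n := n) hn hk hb1 hε hε1
  have hbound : ∀ {x : ℝ}, sampleScale n (k * Real.log k) ε ≤ b ^ 2 * x →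
      (A.sampleCount : ℝ) ≤ 60 * (10 ^ 15 * b ^ 4) * b ^ 2 * x := fun {x} hx => by
    rw [mul_assoc _ (b ^ 2) x]
    exact hT.trans (mul_le_mul_of_nonneg_left hx (by positivity))
  refine ⟨A, fun P Q D hPQ hD => hA P Q D (hPQ.trans ?_) hD, fun h => ?_, fun h h' => ?_,
    fun h => ?_⟩
  · have : 0 ≤ tvDist P Q := by unfold tvDist; positivity
    gcongr
  · rw [mul_assoc _ (k : ℝ)]
    exact hbound (sampleScale_le_of_large hn hb1 hK0 hε hε1 (h.trans (by gcongr)))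
  · rw [mul_assoc _ (k : ℝ)]
    exact hbound (sampleScale_le_of_medium hn hb1 hK0 hε (h.trans (by gcongr))
      (h'.trans (by gcongr)))
  · exact hbound (sampleScale_le_of_small hb1 hK0 hε hε1 (h.trans (by gcongr)))
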